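/- Let $(X,\mu)$ be a standard probability space. An automorphism of $(X,\mu)$ is an invertible measure-preserving transformation, considered up to equality almost everywhere, and we also write $T$ for the unitary operator $Tf(x)=f(Tx)$ on $L_2(X,\mu)$. For an automorphism $T$ we use the following notions. * The weakly homoclinic group of $T$ is $$WH(T)=\Big\{S\in \mathrm{Aut}(\mu):\ \frac1N\sum_{i=1}^N T^{-i}ST^i\to I,\ N\to\infty\Big\},$$ with convergence in the strong operator topology on $L_2(X,\mu)$. * The local rank $\beta(T)$ is the largest number $\beta>0$ for which there is a sequence of countable measurable partitions of $X$ $$\xi_j=\{B_j,TB_j,\dots,T^{h_j-1}B_j,C_j^1,C_j^2,\dots\}$$ that tends to the partition into points (every measurable set is approximated in measure, with error tending to $0$ as $j\to\infty$, by unions of elements of $\xi_j$) and satisfies $\mu\big(\bigsqcup_{0\le k<h_j}T^kB_j\big)\to\beta$; if there is no such $\beta$, we put $\beta(T)=0$. * $T$ is partially rigid with exponent $\rho$ if there are a sequence of positive integers $m(i)\to\infty$ and a Markov operator $P$ on $L_2(X,\mu)$ (that is, $P\ge 0$, $P1=1$, $P^*1=1$) such that $T^{m(i)}\to\rho I+(1-\rho)P$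 in the weak operator topology. **Theorem.** Let $T$ be an ergodic automorphism of a standard probability space with $\beta(T)>0$. If $T$ is not partially rigid with exponent $\beta(T)$, then the group $WH(T)$ is trivial: $WH(T)=\{I\}$. -/

import Mathlib

open MeasureTheory Filter Topology

noncomputable section

/-- The invertible measure-preserving transformations of `(X, μ)`; two of them represent the same
automorphism when they agree almost everywhere. -/
def Aut {X : Type*} [MeasurableSpace X] (μ : Measure X) : Type _ :=
  {S : X ≃ᵐ X // MeasurePreserving S μ μ}

namespace Aut

variable {X : Type*} [MeasurableSpace X] {μ : Measure X}

instance : CoeFun (Aut μ) (fun _ => X → X) := ⟨fun S => S.1⟩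

/-- The inverse automorphism. -/
def inv (S : Aut μ) : Aut μ := ⟨S.1.symm, S.2.symm S.1⟩

/-- The operator `f ↦ f ∘ S` on real `L²(μ)`. -/
def koopman (S : Aut μ) : Lp ℝ 2 μ →L[ℝ] Lp ℝ 2 μ :=
  (Lp.compMeasurePreservingₗᵢ ℝ S S.2).toContinuousLinearMap

end Aut

/-- The weakly homoclinic group `WH(T)`: the automorphisms `S` such that
`(1/N) ∑_{i=1}^N T^{-i} S T^i → I` in the strong operator topology on `L²(μ)`. -/
def WH {X : Type*} [MeasurableSpace X] {μ : Measure X} (T : Aut μ) : Set (Aut μ) :=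
  {S | ∀ f : Lp ℝ 2 μ, Tendsto
    (fun N : ℕ => (N : ℝ)⁻¹ •
      ∑ i ∈ Finset.Icc 1 N, (T.inv.koopman ^ i * S.koopman * T.koopman ^ i) f)
    atTop (𝓝 f)}

/-- Markov operators on `L²(μ)`: `P ≥ 0`, `P 1 = 1` and `P* 1 = 1`. -/
structure IsMarkovOperator {X : Type*} [MeasurableSpace X] {μ : Measure X} [IsProbabilityMeasure μ]
    (P : Lp ℝ 2 μ →L[ℝ] Lp ℝ 2 μ) : Prop where
  nonneg : ∀ f : Lp ℝ 2 μ, 0 ≤ f → 0 ≤ P f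
  map_one : P (Lp.const 2 μ (1 : ℝ)) = Lp.const 2 μ (1 : ℝ)
  adjoint_map_one : P.adjoint (Lp.const 2 μ (1 : ℝ)) = Lp.const 2 μ (1 : ℝ)

/-- Partial rigidity with exponent `ρ`: `T^{m(i)} → ρ I + (1 - ρ) P` in the weak operator topology
for some `m(i) → ∞` and some Markov operator `P`. -/
def IsPartiallyRigid {X : Type*} [MeasurableSpace X] {μ : Measure X} [IsProbabilityMeasure μ]
    (T : Aut μ) (ρ : ℝ) : Prop :=
  ∃ m : ℕ → ℕ, Tendsto m atTop atTop ∧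
    ∃ P : Lp ℝ 2 μ →L[ℝ] Lp ℝ 2 μ, IsMarkovOperator P ∧
      ∀ f g : Lp ℝ 2 μ, Tendsto (fun i => inner ℝ ((T.koopman ^ m i) f) g) atTop
        (𝓝 (inner ℝ (ρ • f + (1 - ρ) • P f) g))

/-- A countable measurable partition `{B, TB, …, T^{h-1}B, C¹, C², …}` of `X`
(some of the sets may be empty, so finite partitions are included). -/
structure TowerPartition {X : Type*} [MeasurableSpace X] (T : X → X) where
  height : ℕ
  base : Set X
  rest : ℕ → Set X
  measurableSet_base : MeasurableSet base
  measurableSet_rest : ∀ l, MeasurableSet (rest l)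
  disjoint_level : ∀ i < height, ∀ k < height, i ≠ k → Disjoint (T^[i] '' base) (T^[k] '' base)
  disjoint_rest : ∀ l n, l ≠ n → Disjoint (rest l) (rest n)
  disjoint_level_rest : ∀ k < height, ∀ l, Disjoint (T^[k] '' base) (rest l)
  cover : (⋃ k < height, T^[k] '' base) ∪ (⋃ l, rest l) = Set.univ

namespace TowerPartition

variable {X : Type*} [MeasurableSpace X] {T : X → X}

/-- The tower `U = ⨆_{0 ≤ k < h} T^k B`. -/
def tower (ξ : TowerPartition T) : Set X := ⋃ k < ξ.height, T^[k] '' ξ.base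

/-- The elements of the partition. -/
def atoms (ξ : TowerPartition T) : Set (Set X) :=
  {E | ∃ k < ξ.height, E = T^[k] '' ξ.base} ∪ Set.range ξ.rest

/-- `ξ`-measurable sets: unions of elements of the partition. -/
def IsMeasurable (ξ : TowerPartition T) (A : Set X) : Prop := ∃ 𝒜 ⊆ ξ.atoms, A = ⋃₀ 𝒜

end TowerPartition

/-- There are partitions `ξ_j = {B_j, TB_j, …, T^{h_j-1}B_j, C_j¹, C_j², …}` which tend to the
partition into points (every measurable set is approximated by `ξ_j`-measurable ones) and whose
towers satisfy `μ(U_j) → β`. -/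
def HasApproximatingPartitions {X : Type*} [MeasurableSpace X] (μ : Measure X) (T : X → X)
    (β : ℝ) : Prop :=
  ∃ ξ : ℕ → TowerPartition T,
    (∀ A, MeasurableSet A → ∃ A' : ℕ → Set X, (∀ j, (ξ j).IsMeasurable (A' j)) ∧
      Tendsto (fun j => μ (symmDiff A (A' j))) atTop (𝓝 0)) ∧
    Tendsto (fun j => μ.real (ξ j).tower) atTop (𝓝 β)

/-- The local rank `β(T)`: the largest `β > 0` admitting approximating partitions, and `0` if there
is no such `β`. -/
def localRank {X : Type*} [MeasurableSpace X] (μ : Measure X) (T : X → X) : ℝ :=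
  sSup {β | 0 < β ∧ HasApproximatingPartitions μ T β}

end

open MeasureTheory Filter Topology

set_option linter.unusedSectionVars false

/-! The failure of partial rigidity is used in a uniform form (`exists_uniform_nonrigidity`): there
is δ > 0 such that, for every fine enough finite code c, no power T^l with l ≥ 1 preserves c up to
an error below δ on an almost invariant set of measure at least β(T) - δ. Otherwise a weak limit of
such powers would dominate β(T)·I, because almost invariant sets are almost independent of any fixed
set (`isPartiallyRigid_of_tendsto`).

The local rank gives a tall tower over B, of measure nearly β(T) or more, whose levels carry letters
w k with small total error. Let E_k be the set of points whose c-name follows w k, ..., w (h-1) with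
at most r errors. A point of both E_k and E_{k+l} would make w nearly l-periodic, so that T^l would
nearly preserve c on a long column of the tower. Hence the E_k with k ≤ 2K are pairwise disjoint. As
T maps E_k into E_{k+1}, their measures do not decrease, and so μ(E_K) ≤ 1/K
(`mul_measureReal_follows_le_one`). Errors counted along T telescope
(`sum_measureReal_follows_inter_ne_le`): the points of some E_k, k < K, whose very first letter is
wrong have total measure at most r·μ(E_K) ≤ r/K. With r = εh and K of order δh this is of order ε/δ,
so a bound on the average number of errors has become a statement about a single letter.

A weakly homoclinic S changes few letters of a long name on average (`tendsto_average_mismatch`). So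
for most y in a level k < K both y and S y lie in E_k, both have the letter w k, and c(S y) = c(y).
If A = {S x ≠ x} had positive measure, the bottom K levels, being almost invariant, would contain
nearly their proportional share of A, whereas a fine code separates S y from y on almost all of A
(`measureReal_moved_eq_zero`). -/

namespace WeaklyHomoclinic

/-! ### Koopman operators, and the meaning of weak homoclinicity for names of points. -/

section Koopman

variable {X : Type*} [MeasurableSpace X] {μ : Measure X} [IsProbabilityMeasure μ]

/-- The indicator function of a measurable set as an element of `L²(μ)`. -/
noncomputable def ind {D : Set X} (hD : MeasurableSet D) : Lp ℝ 2 μ :=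
  indicatorConstLp 2 hD (measure_ne_top μ D) 1

lemma measurableSet_iterate_preimage (T : Aut μ) {D : Set X} (hD : MeasurableSet D) (i : ℕ) :
    MeasurableSet (T^[i] ⁻¹' D) :=
  (T.1.measurable.iterate i) hD

lemma koopman_ind (T : Aut μ) {D : Set X} (hD : MeasurableSet D) :
    T.koopman (ind hD) = ind (T.1.measurable hD) := rfl

lemma koopman_pow_ind (T : Aut μ) {D : Set X} (hD : MeasurableSet D) (i : ℕ) :
    (T.koopman ^ i) (ind hD) = ind (measurableSet_iterate_preimage T hD i) := by
  induction i with
  | zero => rfl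
  | succ i ih =>
    rw [pow_succ', mul_apply_eq_comp, ih, koopman_ind]
    rfl

lemma inner_ind_ind {D F : Set X} (hD : MeasurableSet D) (hF : MeasurableSet F) :
    inner ℝ (ind hD : Lp ℝ 2 μ) (ind hF) = μ.real (D ∩ F) :=
  L2.real_inner_indicatorConstLp_one_indicatorConstLp_one hD hF

lemma const_one_eq_ind :
    Lp.const 2 μ (1 : ℝ) = ind (μ := μ) (X := X) MeasurableSet.univ := by
  rw [ind, indicatorConstLp_univ]

lemma inner_koopman_koopman (T : Aut μ) (f g : Lp ℝ 2 μ) :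
    inner ℝ (T.koopman f) (T.koopman g) = inner ℝ f g :=
  LinearIsometry.inner_map_map _ f g

lemma inner_koopman_pow (T : Aut μ) (i : ℕ) (f g : Lp ℝ 2 μ) :
    inner ℝ ((T.koopman ^ i) f) ((T.koopman ^ i) g) = inner ℝ f g := by
  induction i with
  | zero => rfl
  | succ i ih =>
    rw [pow_succ', mul_apply_eq_comp, mul_apply_eq_comp,
      inner_koopman_koopman, ih]

lemma norm_koopman_pow (T : Aut μ) (i : ℕ) (f : Lp ℝ 2 μ) : ‖(T.koopman ^ i) f‖ = ‖f‖ := by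
  have := inner_koopman_pow T i f f
  rw [real_inner_self_eq_norm_sq, real_inner_self_eq_norm_sq] at this
  exact (sq_eq_sq₀ (norm_nonneg _) (norm_nonneg _)).1 this

lemma koopman_eq_one (S : Aut μ) (hS : S =ᵐ[μ] id) : S.koopman = 1 := by
  ext1 f
  apply Lp.ext
  have h1 : S.koopman f =ᵐ[μ] f ∘ S := Lp.coeFn_compMeasurePreserving f S.2
  filter_upwards [h1, hS] with x hx hSx
  simp [hx, hSx]

lemma koopman_mul_koopman_inv (T : Aut μ) : T.koopman * T.inv.koopman = 1 := by
  ext1 f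
  apply Lp.ext
  have h1 : T.koopman (T.inv.koopman f) =ᵐ[μ] (T.inv.koopman f) ∘ T :=
    Lp.coeFn_compMeasurePreserving _ T.2
  have h2 : (T.inv.koopman f) =ᵐ[μ] f ∘ T.inv := Lp.coeFn_compMeasurePreserving _ T.inv.2
  have h3 := T.2.quasiMeasurePreserving.ae_eq_comp h2
  refine (h1.trans h3).trans (Eventually.of_forall fun x => ?_)
  change f (T.1.symm (T.1 x)) = f x
  rw [MeasurableEquiv.symm_apply_apply]

lemma koopman_inv_mul_koopman (T : Aut μ) : T.inv.koopman * T.koopman = 1 := by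
  ext1 f
  apply Lp.ext
  have h1 : T.inv.koopman (T.koopman f) =ᵐ[μ] (T.koopman f) ∘ T.inv :=
    Lp.coeFn_compMeasurePreserving _ T.inv.2
  have h2 : (T.koopman f) =ᵐ[μ] f ∘ T := Lp.coeFn_compMeasurePreserving _ T.2
  have h3 := T.inv.2.quasiMeasurePreserving.ae_eq_comp h2
  refine (h1.trans h3).trans (Eventually.of_forall fun x => ?_)
  change f (T.1 (T.1.symm x)) = f x
  rw [MeasurableEquiv.apply_symm_apply]

lemma inner_koopman_inv_pow (T : Aut μ) (i : ℕ) (f g : Lp ℝ 2 μ) :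
    inner ℝ ((T.inv.koopman ^ i) f) g = inner ℝ f ((T.koopman ^ i) g) := by
  rw [← inner_koopman_pow T i, ← mul_apply_eq_comp]
  have hc : Commute T.koopman T.inv.koopman := by
    rw [Commute, SemiconjBy, koopman_mul_koopman_inv, koopman_inv_mul_koopman]
  rw [← hc.mul_pow, koopman_mul_koopman_inv, one_pow]
  rfl

lemma ae_eq_id_mem_WH (T S : Aut μ) (hS : S =ᵐ[μ] id) : S ∈ WH T := by
  intro f
  have hc : Commute T.inv.koopman T.koopman := by
    rw [Commute, SemiconjBy, koopman_mul_koopman_inv, koopman_inv_mul_koopman]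
  refine tendsto_const_nhds.congr' ?_
  filter_upwards [eventually_gt_atTop 0] with N hN
  have h : ∀ i, (T.inv.koopman ^ i * S.koopman * T.koopman ^ i) f = f := fun i => by
    rw [koopman_eq_one S hS, mul_one, ← hc.mul_pow, koopman_inv_mul_koopman, one_pow]
    rfl
  simp only [h, Finset.sum_const, Nat.card_Icc, Nat.add_sub_cancel]
  rw [← Nat.cast_smul_eq_nsmul ℝ, smul_smul, inv_mul_cancel₀ (by positivity), one_smul]

/-- A weakly homoclinic `S` moves almost every point to one with asymptotically the same orbit in
the mean, as seen by a finite measurable partition. -/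
lemma tendsto_average_mismatch {ι : Type*} [Fintype ι] [DecidableEq ι] [MeasurableSpace ι]
    [MeasurableSingletonClass ι]
    (T S : Aut μ) (hS : S ∈ WH T) (c : X → ι) (hc : Measurable c) :
    Tendsto (fun N : ℕ => (N : ℝ)⁻¹ * ∑ i ∈ Finset.Icc 1 N,
      μ.real {y | c (T^[i] (S y)) ≠ c (T^[i] y)}) atTop (𝓝 0) := by
  have hm : ∀ a, MeasurableSet (c ⁻¹' {a}) := fun a => hc (measurableSet_singleton a)
  -- Splitting the disagreement set by the letter a = c(T^i y): each piece is the set where T^i y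
  -- has letter a, minus the part where T^i (S y) has it too. The latter measure is a matrix
  -- coefficient of T^{-i} S T^i.
  have key : ∀ i, μ.real {y | c (T^[i] (S y)) ≠ c (T^[i] y)} = ∑ a : ι, (μ.real (c ⁻¹' {a}) -
      inner ℝ ((T.inv.koopman ^ i * S.koopman * T.koopman ^ i) (ind (hm a))) (ind (hm a))) := by
    intro i
    have e : ∀ a, inner ℝ ((T.inv.koopman ^ i * S.koopman * T.koopman ^ i) (ind (hm a)))
        (ind (hm a)) = μ.real {y | c (T^[i] (S y)) = a ∧ c (T^[i] y) = a} := by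
      intro a
      rw [mul_apply_eq_comp, mul_apply_eq_comp, inner_koopman_inv_pow,
        koopman_pow_ind, koopman_ind, inner_ind_ind]
      rfl
    have hTi := T.2.iterate i
    have hcT : Measurable (fun y => c (T^[i] y)) := hc.comp hTi.measurable
    have hcS : Measurable (fun y => c (T^[i] (S y))) := hcT.comp S.1.measurable
    have e1 : ∀ a, μ.real (c ⁻¹' {a}) = μ.real {y | c (T^[i] y) = a} := fun a =>
      (hTi.measureReal_preimage (hm a).nullMeasurableSet).symm
    have hm1 : ∀ a, MeasurableSet {y | c (T^[i] y) = a} := fun a =>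
      hcT (measurableSet_singleton a)
    have hm2 : ∀ a, MeasurableSet {y | c (T^[i] (S y)) = a} := fun a =>
      hcS (measurableSet_singleton a)
    have e2 : ∀ a, μ.real {y | c (T^[i] y) = a} -
        μ.real {y | c (T^[i] (S y)) = a ∧ c (T^[i] y) = a} =
        μ.real {y | c (T^[i] (S y)) ≠ c (T^[i] y) ∧ c (T^[i] y) = a} := by
      intro a
      have := measureReal_inter_add_sdiff (μ := μ) (s := {y | c (T^[i] y) = a}) (hm2 a)
      rw [← this]
      have a1 : {y | c (T^[i] y) = a} ∩ {y | c (T^[i] (S y)) = a} =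
          {y | c (T^[i] (S y)) = a ∧ c (T^[i] y) = a} := by ext; simp [and_comm]
      have a2 : {y | c (T^[i] y) = a} \ {y | c (T^[i] (S y)) = a} =
          {y | c (T^[i] (S y)) ≠ c (T^[i] y) ∧ c (T^[i] y) = a} := by
        ext y
        simp only [Set.mem_sdiff, Set.mem_ofPred_eq]
        constructor
        · rintro ⟨h1, h2⟩; exact ⟨by rwa [h1], h1⟩
        · rintro ⟨h1, h2⟩; exact ⟨h2, by rwa [h2] at h1⟩
      rw [a1, a2]
      ring
    simp only [e, e1, e2]
    have hne : MeasurableSet {y | c (T^[i] (S y)) ≠ c (T^[i] y)} :=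
      (measurableSet_eq_fun hcS hcT).compl
    rw [← measureReal_iUnion_fintype]
    · congr 1
      ext y
      simp
    · intro a b hab
      rw [Function.onFun, Set.disjoint_left]
      rintro y ⟨-, h1⟩ ⟨-, h2⟩
      exact hab (h1.symm.trans h2)
    · intro a
      exact hne.inter (hm1 a)
  have key2 : ∀ N : ℕ, 0 < N → (N : ℝ)⁻¹ * ∑ i ∈ Finset.Icc 1 N,
      μ.real {y | c (T^[i] (S y)) ≠ c (T^[i] y)} = ∑ a : ι, (μ.real (c ⁻¹' {a}) -
      inner ℝ ((N : ℝ)⁻¹ • ∑ i ∈ Finset.Icc 1 N,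
        (T.inv.koopman ^ i * S.koopman * T.koopman ^ i) (ind (hm a))) (ind (hm a))) := by
    intro N hN
    simp only [key]
    rw [Finset.sum_comm, Finset.mul_sum]
    refine Finset.sum_congr rfl fun a _ => ?_
    rw [Finset.sum_sub_distrib, real_inner_smul_left, sum_inner, mul_sub]
    simp only [Finset.sum_const, Nat.card_Icc, Nat.add_sub_cancel, nsmul_eq_mul]
    rw [inv_mul_cancel_left₀ (by positivity)]
  have lim : Tendsto (fun N : ℕ => ∑ a : ι, (μ.real (c ⁻¹' {a}) -
      inner ℝ ((N : ℝ)⁻¹ • ∑ i ∈ Finset.Icc 1 N,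
        (T.inv.koopman ^ i * S.koopman * T.koopman ^ i) (ind (hm a))) (ind (hm a))))
      atTop (𝓝 (∑ a : ι, (μ.real (c ⁻¹' {a}) - inner ℝ (ind (hm a) : Lp ℝ 2 μ) (ind (hm a))))) :=
    tendsto_finsetSum _ fun a _ =>
      tendsto_const_nhds.sub ((hS (ind (hm a))).inner tendsto_const_nhds)
  have z : (∑ a : ι, (μ.real (c ⁻¹' {a}) - inner ℝ (ind (hm a) : Lp ℝ 2 μ) (ind (hm a)))) = 0 :=
    Finset.sum_eq_zero fun a _ => by rw [inner_ind_ind, Set.inter_self, sub_self]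
  rw [z] at lim
  refine lim.congr' ?_
  filter_upwards [eventually_gt_atTop 0] with N hN
  exact (key2 N hN).symm

end Koopman

/-! ### Mean ergodic theorem and almost invariant sets. -/

section Ergodic

variable {X : Type*} [MeasurableSpace X] {μ : Measure X} [IsProbabilityMeasure μ]

lemma abs_measureReal_sub_le_symmDiff {s t : Set X} :
    |μ.real s - μ.real t| ≤ μ.real (symmDiff s t) := by
  have h : ∀ s t : Set X, μ.real s - μ.real t ≤ μ.real (symmDiff s t) := fun s t => by
    have h1 : μ.real s ≤ μ.real (symmDiff s t ∪ t) := measureReal_mono (by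
      intro x hx
      by_cases hxt : x ∈ t
      · exact Or.inr hxt
      · exact Or.inl (Or.inl ⟨hx, hxt⟩))
    linarith [measureReal_union_le (μ := μ) (symmDiff s t) t]
  rw [abs_le]
  constructor
  · have := h t s
    rw [symmDiff_comm] at this
    linarith
  · exact h s t

lemma measureReal_symmDiff_iterate_le (T : Aut μ) {U : Set X} (hU : MeasurableSet U) (i : ℕ) :
    μ.real (symmDiff (T^[i] ⁻¹' U) U) ≤ i * μ.real (symmDiff (T ⁻¹' U) U) := by
  induction i with
  | zero => simp
  | succ i ih =>
    have h1 := measureReal_symmDiff_le (μ := μ) (s := T^[i + 1] ⁻¹' U) (t := T^[i] ⁻¹' U) U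
    have h2 : μ.real (symmDiff (T^[i + 1] ⁻¹' U) (T^[i] ⁻¹' U)) = μ.real (symmDiff (T ⁻¹' U) U) := by
      rw [← (T.2.iterate i).measureReal_preimage
        ((T.1.measurable hU).symmDiff hU).nullMeasurableSet, Function.iterate_succ']
      rfl
    push_cast
    linarith

lemma koopman_iterate_ind (T : Aut μ) {D : Set X} (hD : MeasurableSet D) (i : ℕ) :
    T.koopman^[i] (ind hD) = ind (measurableSet_iterate_preimage T hD i) := by
  induction i with
  | zero => rfl
  | succ i ih =>
    rw [Function.iterate_succ_apply', ih, koopman_ind]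
    rfl

/-- The means of an indicator function along an ergodic automorphism converge in `L²`. -/
lemma tendsto_birkhoffAverage_ind (T : Aut μ) (hT : Ergodic T μ) {A : Set X}
    (hA : MeasurableSet A) :
    Tendsto (fun N => birkhoffAverage ℝ T.koopman _root_.id N (ind hA)) atTop
      (𝓝 (μ.real A • Lp.const 2 μ (1 : ℝ))) := by
  have hnorm : ‖T.koopman‖ ≤ 1 := LinearIsometry.norm_toContinuousLinearMap_le _
  have h := T.koopman.tendsto_birkhoffAverage_orthogonalProjection hnorm (ind hA)
  set P := (T.koopman.eqLocus (1 : Lp ℝ 2 μ →L[ℝ] Lp ℝ 2 μ)) with hP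
  set v := P.orthogonalProjectionOnto (ind hA) with hv
  have hfix : T.koopman (v : Lp ℝ 2 μ) = v := v.2
  -- Ergodicity makes the limit a constant; its value is found below by pairing with the constant
  -- function 1.
  obtain ⟨r, hr⟩ : ∃ r : ℝ, (v : Lp ℝ 2 μ) =ᵐ[μ] Function.const X r := by
    refine hT.ae_eq_const_of_ae_eq_comp_ae (Lp.aestronglyMeasurable _) ?_
    have h1 : T.koopman (v : Lp ℝ 2 μ) =ᵐ[μ] (v : Lp ℝ 2 μ) ∘ T :=
      Lp.coeFn_compMeasurePreserving _ T.2
    rw [hfix] at h1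
    exact h1.symm
  have hvr : (v : Lp ℝ 2 μ) = r • Lp.const 2 μ (1 : ℝ) := by
    apply Lp.ext
    filter_upwards [hr, Lp.coeFn_smul r (Lp.const 2 μ (1 : ℝ)), Lp.coeFn_const (p := 2) (μ := μ)
      (1 : ℝ)] with x h1 h2 h3
    rw [h1, h2, Pi.smul_apply, h3]
    simp
  have hone : inner ℝ (Lp.const 2 μ (1 : ℝ)) (Lp.const 2 μ (1 : ℝ)) = 1 := by
    rw [const_one_eq_ind, inner_ind_ind]; simp
  have hmem : Lp.const 2 μ (1 : ℝ) ∈ P := by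
    change T.koopman (Lp.const 2 μ (1 : ℝ)) = Lp.const 2 μ (1 : ℝ)
    rw [const_one_eq_ind, koopman_ind]
    rfl
  have h3 : inner ℝ (ind hA : Lp ℝ 2 μ) (Lp.const 2 μ (1 : ℝ)) =
      inner ℝ (v : Lp ℝ 2 μ) (Lp.const 2 μ (1 : ℝ)) := by
    have := Submodule.sub_starProjection_mem_orthogonal (K := P) (ind hA : Lp ℝ 2 μ)
    have h4 := (Submodule.mem_orthogonal' _ _).1 this _ hmem
    rw [inner_sub_left, sub_eq_zero] at h4
    exact h4
  rw [hvr, real_inner_smul_left, hone, mul_one, const_one_eq_ind, inner_ind_ind,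
    Set.inter_univ] at h3
  rw [h3, ← hvr]
  exact h

/-- Almost invariant sets of an ergodic automorphism are almost independent of a fixed set. -/
lemma exists_almost_independent (T : Aut μ) (hT : Ergodic T μ) {A : Set X} (hA : MeasurableSet A)
    {η : ℝ} (hη : 0 < η) : ∃ κ > 0, ∀ U : Set X, MeasurableSet U →
      μ.real (symmDiff (T ⁻¹' U) U) ≤ κ → |μ.real (U ∩ A) - μ.real U * μ.real A| ≤ η := by
  have h := tendsto_birkhoffAverage_ind T hT hA
  rw [Metric.tendsto_atTop] at h
  obtain ⟨N₀, hN₀⟩ := h (η / 2) (by positivity)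
  set N := N₀ + 1
  have hN : (0 : ℝ) < N := by positivity
  have hb := hN₀ N (Nat.le_succ _)
  -- With this κ, each of the N shifts moves U by at most N·κ = η/2, so the average of μ(U ∩ T^{-i}
  -- A) is within η/2 of μ(U ∩ A). The other η/2 is the error in the mean ergodic theorem.
  refine ⟨η / 2 / N, by positivity, fun U hU hκ => ?_⟩
  have e1 : |inner ℝ (ind hU : Lp ℝ 2 μ) (birkhoffAverage ℝ T.koopman _root_.id N (ind hA) -
      μ.real A • Lp.const 2 μ (1 : ℝ))| ≤ η / 2 := by
    refine (abs_real_inner_le_norm _ _).trans ?_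
    rw [dist_eq_norm] at hb
    have hn : ‖(ind hU : Lp ℝ 2 μ)‖ ≤ 1 := by
      rw [← sq_le_one_iff₀ (norm_nonneg _), ← real_inner_self_eq_norm_sq, inner_ind_ind]
      exact measureReal_le_one
    calc _ ≤ 1 * (η / 2) := by gcongr
      _ = η / 2 := one_mul _
  have e2 : inner ℝ (ind hU : Lp ℝ 2 μ) (birkhoffAverage ℝ T.koopman _root_.id N (ind hA) -
      μ.real A • Lp.const 2 μ (1 : ℝ)) =
      (N : ℝ)⁻¹ * ∑ i ∈ Finset.range N, (μ.real (U ∩ T^[i] ⁻¹' A)) - μ.real U * μ.real A := by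
    rw [inner_sub_right, real_inner_smul_right, const_one_eq_ind, inner_ind_ind, Set.inter_univ,
      birkhoffAverage, birkhoffSum, real_inner_smul_right, inner_sum, mul_comm (μ.real A)]
    congr 2
    refine Finset.sum_congr rfl fun i _ => ?_
    rw [← inner_ind_ind hU (measurableSet_iterate_preimage T hA i), id_eq, koopman_iterate_ind]
  have e3 : |(N : ℝ)⁻¹ * ∑ i ∈ Finset.range N, (μ.real (U ∩ T^[i] ⁻¹' A)) - μ.real (U ∩ A)|
      ≤ η / 2 := by
    have e4 : (N : ℝ)⁻¹ * ∑ i ∈ Finset.range N, (μ.real (U ∩ T^[i] ⁻¹' A)) - μ.real (U ∩ A) =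
        (N : ℝ)⁻¹ * ∑ i ∈ Finset.range N, (μ.real (U ∩ T^[i] ⁻¹' A) - μ.real (U ∩ A)) := by
      rw [Finset.sum_sub_distrib, mul_sub, Finset.sum_const, Finset.card_range, nsmul_eq_mul,
        inv_mul_cancel_left₀ hN.ne']
    rw [e4, abs_mul, abs_of_pos (by positivity : (0 : ℝ) < (N : ℝ)⁻¹)]
    have e5 : ∀ i ∈ Finset.range N, |μ.real (U ∩ T^[i] ⁻¹' A) - μ.real (U ∩ A)| ≤ η / 2 := by
      intro i hi
      have : μ.real (U ∩ A) = μ.real (T^[i] ⁻¹' U ∩ T^[i] ⁻¹' A) :=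
        ((T.2.iterate i).measureReal_preimage (hU.inter hA).nullMeasurableSet).symm
      rw [this]
      refine abs_measureReal_sub_le_symmDiff.trans ?_
      calc _ ≤ μ.real (symmDiff (T^[i] ⁻¹' U) U) := measureReal_mono (by
            rintro x (⟨⟨h1, h2⟩, h3⟩ | ⟨⟨h1, h2⟩, h3⟩)
            · exact Or.inr ⟨h1, fun h => h3 ⟨h, h2⟩⟩
            · exact Or.inl ⟨h1, fun h => h3 ⟨h, h2⟩⟩)
        _ ≤ i * μ.real (symmDiff (T ⁻¹' U) U) := measureReal_symmDiff_iterate_le T hU i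
        _ ≤ N * (η / 2 / N) := by
            have : (i : ℝ) ≤ N := by exact_mod_cast (Finset.mem_range.1 hi).le
            gcongr
        _ = η / 2 := by field_simp
    calc _ ≤ (N : ℝ)⁻¹ * (N * (η / 2)) := by
          gcongr
          refine (Finset.abs_sum_le_sum_abs _ _).trans ((Finset.sum_le_sum e5).trans ?_)
          simp
      _ = η / 2 := inv_mul_cancel_left₀ hN.ne' _
  rw [e2] at e1
  rw [abs_le] at *
  constructor <;> linarith [e1.1, e1.2, e3.1, e3.2]

end Ergodic

section Tower

variable {X : Type*} [MeasurableSpace X] {μ : Measure X} [IsProbabilityMeasure μ]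

/-! ### Towers -/

lemma measurableSet_level (T : Aut μ) {B : Set X} (hB : MeasurableSet B) (k : ℕ) :
    MeasurableSet (T^[k] '' B) := by
  induction k with
  | zero => simpa using hB
  | succ k ih =>
    rw [Function.iterate_succ', Set.image_comp]
    exact T.1.measurableSet_image.2 ih

lemma preimage_level (T : Aut μ) (B : Set X) (i k : ℕ) :
    T^[i] ⁻¹' (T^[k + i] '' B) = T^[k] '' B := by
  rw [add_comm, Function.iterate_add, Set.image_comp]
  exact Set.preimage_image_eq _ (T.1.injective.iterate i)

lemma measureReal_level_inter (T : Aut μ) {B D : Set X} (hB : MeasurableSet B)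
    (hD : MeasurableSet D) (i k : ℕ) :
    μ.real (T^[k] '' B ∩ T^[i] ⁻¹' D) = μ.real (T^[k + i] '' B ∩ D) := by
  rw [← preimage_level T B i k, ← Set.preimage_inter]
  exact (T.2.iterate i).measureReal_preimage
    ((measurableSet_level T hB _).inter hD).nullMeasurableSet

lemma measureReal_level (T : Aut μ) {B : Set X} (hB : MeasurableSet B) (k : ℕ) :
    μ.real (T^[k] '' B) = μ.real B := by
  have := measureReal_level_inter T hB MeasurableSet.univ k 0
  simpa using this.symm

/-- The sets `B, TB, …, T^{h-1}B` form a tower. -/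
structure IsTower (T : Aut μ) (B : Set X) (h : ℕ) : Prop where
  measurableSet : MeasurableSet B
  disjoint : ∀ i < h, ∀ k < h, i ≠ k → Disjoint (T^[i] '' B) (T^[k] '' B)

/-- The union of the levels `a ≤ k < b` over `B`. -/
def column (T : Aut μ) (B : Set X) (a b : ℕ) : Set X := ⋃ k ∈ Finset.Ico a b, T^[k] '' B

lemma measurableSet_column (T : Aut μ) {B : Set X} (hB : MeasurableSet B) (a b : ℕ) :
    MeasurableSet (column T B a b) :=
  Finset.measurableSet_biUnion _ fun k _ => measurableSet_level T hB k

lemma measureReal_column_inter (T : Aut μ) {B : Set X} {h : ℕ} (hB : IsTower T B h) {a b : ℕ}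
    (hb : b ≤ h) {D : Set X} (hD : MeasurableSet D) :
    μ.real (column T B a b ∩ D) = ∑ k ∈ Finset.Ico a b, μ.real (T^[k] '' B ∩ D) := by
  rw [column, Set.iUnion₂_inter, measureReal_biUnion_finset]
  · intro i hi k hk hik
    have hi := (Finset.mem_Ico.1 hi).2
    have hk := (Finset.mem_Ico.1 hk).2
    exact (hB.disjoint i (by omega) k (by omega) hik).mono Set.inter_subset_left
      Set.inter_subset_left
  · exact fun k _ => (measurableSet_level T hB.measurableSet k).inter hD

lemma measureReal_column (T : Aut μ) {B : Set X} {h : ℕ} (hB : IsTower T B h) {a b : ℕ}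
    (hb : b ≤ h) : μ.real (column T B a b) = (b - a : ℕ) * μ.real B := by
  have := measureReal_column_inter T hB (a := a) hb MeasurableSet.univ
  simpa [measureReal_level T hB.measurableSet] using this

/-- Only the two ends of a column are affected by a shift: interior levels are mapped to levels of
the same column. The bound does not depend on the number of levels, so every column over a small
base is almost invariant. -/
lemma measureReal_symmDiff_column_le (T : Aut μ) {B : Set X} (hB : MeasurableSet B) (a b : ℕ) :
    μ.real (symmDiff (T ⁻¹' column T B a b) (column T B a b)) ≤ 2 * μ.real B := by
  have hpre : ∀ k, T ⁻¹' (T^[k + 1] '' B) = T^[k] '' B := fun k => preimage_level T B 1 k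
  have hsub : symmDiff (T ⁻¹' column T B a b) (column T B a b) ⊆
      T ⁻¹' (T^[a] '' B) ∪ T^[b - 1] '' B := by
    rintro x (⟨h1, h2⟩ | ⟨h1, h2⟩)
    · simp only [column, Set.mem_preimage, Set.mem_iUnion, Finset.mem_Ico] at h1 h2
      obtain ⟨k, ⟨hak, hkb⟩, hx⟩ := h1
      rcases eq_or_lt_of_le hak with rfl | hlt
      · exact Or.inl hx
      · obtain ⟨j, rfl⟩ : ∃ j, k = j + 1 := ⟨k - 1, by omega⟩
        refine absurd ⟨j, ⟨by omega, by omega⟩, ?_⟩ h2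
        rw [← hpre j]
        exact hx
    · simp only [column, Set.mem_preimage, Set.mem_iUnion, Finset.mem_Ico] at h1 h2
      obtain ⟨k, ⟨hak, hkb⟩, hx⟩ := h1
      by_cases hk : k + 1 = b
      · right
        rwa [← hk]
      · refine absurd ⟨k + 1, ⟨by omega, by omega⟩, ?_⟩ h2
        rw [← hpre k] at hx
        exact hx
  refine (measureReal_mono hsub).trans ((measureReal_union_le _ _).trans ?_)
  rw [T.2.measureReal_preimage (measurableSet_level T hB a).nullMeasurableSet,
    measureReal_level T hB, measureReal_level T hB]
  linarith

/-! ### Names along a tower -/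

variable {ι : Type*} [Countable ι] [MeasurableSpace ι] [MeasurableSingletonClass ι]

/-- The number of errors when the `c`-name of `z` is compared with the letters `w k, …, w (h-1)`. -/
noncomputable def mismatch (T : Aut μ) (c : X → ι) (w : ℕ → ι) (h k : ℕ) (z : X) : ℝ :=
  ∑ i ∈ Finset.range (h - k), {y | c y ≠ w (k + i)}.indicator 1 (T^[i] z)

/-- The points whose name agrees with `w k, …, w (h-1)` up to at most `r` errors. -/
def follows (T : Aut μ) (c : X → ι) (w : ℕ → ι) (h : ℕ) (r : ℝ) (k : ℕ) : Set X :=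
  {z | mismatch T c w h k z ≤ r}

lemma measurableSet_ne {c : X → ι} (hc : Measurable c) (a : ι) : MeasurableSet {y | c y ≠ a} :=
  (hc (measurableSet_singleton a)).compl

lemma indicator_one_nonneg (D : Set X) (x : X) : (0 : ℝ) ≤ D.indicator 1 x :=
  Set.indicator_nonneg (fun _ _ => zero_le_one) x

lemma indicator_one_le (D : Set X) (x : X) : D.indicator (1 : X → ℝ) x ≤ 1 :=
  Set.indicator_le_self' (fun _ _ => zero_le_one) x

lemma mismatch_nonneg (T : Aut μ) (c : X → ι) (w : ℕ → ι) (h k : ℕ) (z : X) :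
    0 ≤ mismatch T c w h k z :=
  Finset.sum_nonneg fun _ _ => indicator_one_nonneg _ _

lemma mismatch_le (T : Aut μ) (c : X → ι) (w : ℕ → ι) (h k : ℕ) (z : X) :
    mismatch T c w h k z ≤ h := by
  refine (Finset.sum_le_sum fun i _ => indicator_one_le _ _).trans ?_
  simp

lemma mismatch_eq_add (T : Aut μ) (c : X → ι) (w : ℕ → ι) {h k : ℕ} (hk : k < h) (z : X) :
    mismatch T c w h k z =
      {y | c y ≠ w k}.indicator 1 z + mismatch T c w h (k + 1) (T z) := by
  unfold mismatch
  rw [show h - k = h - (k + 1) + 1 by omega, Finset.sum_range_succ', add_comm]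
  congr 1
  refine Finset.sum_congr rfl fun i _ => ?_
  rw [Function.iterate_succ_apply, show k + (i + 1) = k + 1 + i by omega]

lemma measurable_mismatch (T : Aut μ) {c : X → ι} (hc : Measurable c) (w : ℕ → ι) (h k : ℕ) :
    Measurable (mismatch T c w h k) :=
  Finset.measurable_fun_sum _ fun i _ =>
    (measurable_one.indicator (measurableSet_ne hc _)).comp (T.1.measurable.iterate i)

lemma integrable_mismatch (T : Aut μ) {c : X → ι} (hc : Measurable c) (w : ℕ → ι) (h k : ℕ) :
    Integrable (mismatch T c w h k) μ :=
  Integrable.of_bound (measurable_mismatch T hc w h k).aestronglyMeasurable h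
    (Eventually.of_forall fun z => by
      rw [Real.norm_of_nonneg (mismatch_nonneg ..)]
      exact mismatch_le ..)

lemma measurableSet_follows (T : Aut μ) {c : X → ι} (hc : Measurable c) (w : ℕ → ι) (h : ℕ)
    (r : ℝ) (k : ℕ) : MeasurableSet (follows T c w h r k) :=
  measurableSet_le (measurable_mismatch T hc w h k) measurable_const

lemma follows_subset_preimage (T : Aut μ) (c : X → ι) (w : ℕ → ι) {h : ℕ} (r : ℝ) {k : ℕ}
    (hk : k < h) : follows T c w h r k ⊆ T ⁻¹' follows T c w h r (k + 1) := by
  intro z hz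
  have h1 : mismatch T c w h k z ≤ r := hz
  rw [mismatch_eq_add T c w hk] at h1
  have := indicator_one_nonneg {y | c y ≠ w k} z
  change mismatch T c w h (k + 1) (T z) ≤ r
  linarith

lemma measureReal_follows_mono (T : Aut μ) {c : X → ι} (hc : Measurable c) (w : ℕ → ι) {h : ℕ}
    (r : ℝ) {k : ℕ} (hk : k < h) :
    μ.real (follows T c w h r k) ≤ μ.real (follows T c w h r (k + 1)) := by
  rw [← T.2.measureReal_preimage (measurableSet_follows T hc w h r (k + 1)).nullMeasurableSet]
  exact measureReal_mono (follows_subset_preimage T c w r hk)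

lemma integral_indicator_one' {D E : Set X} (hD : MeasurableSet D) :
    ∫ x in E, D.indicator (1 : X → ℝ) x ∂μ = μ.real (E ∩ D) := by
  rw [integral_indicator_one hD, measureReal_restrict_apply hD, Set.inter_comm]

/-- Integrate the recursion for `mismatch` over E_k. The first-letter error is what is lost in
passing from ∫_{E_k} to ∫_{E_{k+1}}, except for the points of T⁻¹ E_{k+1} outside E_k; there the
remaining mismatch is at most r, which gives the last term. -/
lemma measureReal_follows_inter_ne_le (T : Aut μ) {c : X → ι} (hc : Measurable c) (w : ℕ → ι)
    {h : ℕ} (r : ℝ) {k : ℕ} (hk : k < h) :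
    μ.real (follows T c w h r k ∩ {y | c y ≠ w k}) ≤
      (∫ z in follows T c w h r k, mismatch T c w h k z ∂μ) -
        (∫ z in follows T c w h r (k + 1), mismatch T c w h (k + 1) z ∂μ) +
        r * (μ.real (follows T c w h r (k + 1)) - μ.real (follows T c w h r k)) := by
  set E := follows T c w h r
  have hE : ∀ k, MeasurableSet (E k) := measurableSet_follows T hc w h r
  have hint : Integrable (fun z => mismatch T c w h (k + 1) (T z)) μ :=
    T.2.integrable_comp_of_integrable (integrable_mismatch T hc w h (k + 1))
  have hTE : MeasurableSet (T ⁻¹' E (k + 1)) := T.1.measurable (hE _)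
  have hsub : E k ⊆ T ⁻¹' E (k + 1) := follows_subset_preimage T c w r hk
  have e1 : ∫ z in E k, mismatch T c w h k z ∂μ =
      μ.real (E k ∩ {y | c y ≠ w k}) + ∫ z in E k, mismatch T c w h (k + 1) (T z) ∂μ := by
    rw [← integral_indicator_one' (measurableSet_ne hc _), ← integral_add]
    · exact setIntegral_congr_fun (hE k) fun z _ => mismatch_eq_add T c w hk z
    · exact ((integrable_const (1 : ℝ)).indicator (measurableSet_ne hc _)).integrableOn
    · exact hint.integrableOn
  have e2 : ∫ z in E (k + 1), mismatch T c w h (k + 1) z ∂μ =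
      ∫ z in T ⁻¹' E (k + 1), mismatch T c w h (k + 1) (T z) ∂μ :=
    (T.2.setIntegral_preimage_emb T.1.measurableEmbedding _ _).symm
  have e3 : ∫ z in T ⁻¹' E (k + 1), mismatch T c w h (k + 1) (T z) ∂μ =
      (∫ z in T ⁻¹' E (k + 1) \ E k, mismatch T c w h (k + 1) (T z) ∂μ) +
        ∫ z in E k, mismatch T c w h (k + 1) (T z) ∂μ := by
    rw [← setIntegral_union Set.disjoint_sdiff_left (hE k) hint.integrableOn hint.integrableOn,
      Set.sdiff_union_of_subset hsub]
  have e4 : ∫ z in T ⁻¹' E (k + 1) \ E k, mismatch T c w h (k + 1) (T z) ∂μ ≤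
      r * μ.real (T ⁻¹' E (k + 1) \ E k) := by
    have : ∫ z in T ⁻¹' E (k + 1) \ E k, mismatch T c w h (k + 1) (T z) ∂μ ≤
        ∫ z in T ⁻¹' E (k + 1) \ E k, r ∂μ :=
      setIntegral_mono_on hint.integrableOn (integrable_const r).integrableOn (hTE.diff (hE k))
        fun z hz => hz.1
    rwa [setIntegral_const, smul_eq_mul, mul_comm] at this
  rw [measureReal_sdiff hsub (hE k), T.2.measureReal_preimage (hE _).nullMeasurableSet] at e4
  linarith

/-- The bounds telescope, and the initial integral over E_0 is at most r·μ(E_0). The result depends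
only on μ(E_K), without a factor K. -/
lemma sum_measureReal_follows_inter_ne_le (T : Aut μ) {c : X → ι} (hc : Measurable c)
    (w : ℕ → ι) {h : ℕ} (r : ℝ) {K : ℕ} (hK : K ≤ h) :
    ∑ k ∈ Finset.range K, μ.real (follows T c w h r k ∩ {y | c y ≠ w k}) ≤
      r * μ.real (follows T c w h r K) := by
  set a : ℕ → ℝ := fun k => ∫ z in follows T c w h r k, mismatch T c w h k z ∂μ
  have h1 : ∑ k ∈ Finset.range K, μ.real (follows T c w h r k ∩ {y | c y ≠ w k}) ≤
      a 0 - a K + r * (μ.real (follows T c w h r K) - μ.real (follows T c w h r 0)) := by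
    induction K with
    | zero => simp
    | succ K ih =>
      rw [Finset.sum_range_succ]
      have := ih (by omega)
      have := measureReal_follows_inter_ne_le T hc w r (show K < h by omega)
      simp only [a] at *
      linarith
  have h2 : a 0 ≤ r * μ.real (follows T c w h r 0) := by
    have : a 0 ≤ ∫ z in follows T c w h r 0, r ∂μ :=
      setIntegral_mono_on (integrable_mismatch T hc w h 0).integrableOn
        (integrable_const r).integrableOn (measurableSet_follows T hc w h r 0) fun z hz => hz
    rwa [setIntegral_const, smul_eq_mul, mul_comm] at this
  have h3 : 0 ≤ a K := setIntegral_nonneg (measurableSet_follows T hc w h r K)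
    fun z _ => mismatch_nonneg ..
  linarith

end Tower

/-! ### Uniqueness of the level from which a name is followed, and its use for S. -/

section TowerNames

variable {X : Type*} [MeasurableSpace X] {μ : Measure X} [IsProbabilityMeasure μ]
variable {ι : Type*} [Countable ι] [MeasurableSpace ι] [MeasurableSingletonClass ι]

/-- The total error made by reading the letters `w k` on the levels of a tower. -/
noncomputable def towerError (μ : Measure X) (T : Aut μ) (c : X → ι) (w : ℕ → ι) (B : Set X)
    (h : ℕ) : ℝ :=
  ∑ k ∈ Finset.range h, μ.real (T^[k] '' B ∩ {y | c y ≠ w k})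

lemma sum_comp_add_le_towerError (T : Aut μ) (c : X → ι) (w : ℕ → ι) (B : Set X) {h k n : ℕ}
    (hn : k + n ≤ h) :
    ∑ i ∈ Finset.range n, μ.real (T^[k + i] '' B ∩ {y | c y ≠ w (k + i)}) ≤
      towerError μ T c w B h := by
  rw [towerError, ← Finset.sum_image (s := Finset.range n) (g := fun i => k + i)
    (f := fun i => μ.real (T^[i] '' B ∩ {y | c y ≠ w i})) (fun _ _ _ _ => by simp)]
  refine Finset.sum_le_sum_of_subset_of_nonneg ?_ fun _ _ _ => measureReal_nonneg
  intro j hj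
  obtain ⟨i, hi, rfl⟩ := Finset.mem_image.1 hj
  have := Finset.mem_range.1 hi
  exact Finset.mem_range.2 (by omega)

open Classical in
/-- A point following the name of a tower from two different levels makes the tower almost
periodic. -/
lemma measureReal_column_shift_le (T : Aut μ) {c : X → ι} (hc : Measurable c) (w : ℕ → ι)
    {B : Set X} {h : ℕ} (hB : IsTower T B h) (r : ℝ) {k l : ℕ} (hkl : k + l ≤ h) {z : X}
    (h1 : z ∈ follows T c w h r k) (h2 : z ∈ follows T c w h r (k + l)) :
    μ.real {x | x ∈ column T B k (h - l) ∧ c (T^[l] x) ≠ c x} ≤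
      2 * towerError μ T c w B h + 2 * r * μ.real B := by
  set n := h - (k + l) with hn
  have hBm := hB.measurableSet
  have hD : MeasurableSet {x | c (T^[l] x) ≠ c x} :=
    (measurableSet_eq_fun (hc.comp (T.1.measurable.iterate l)) hc).compl
  -- Both words are compared with the same name of z, each with at most r errors, so they differ
  -- from each other in at most 2r places.
  have hcount : ∑ i ∈ Finset.range n, (if w (k + i) ≠ w (k + l + i) then (1 : ℝ) else 0) ≤
      2 * r := by
    have e1 : ∑ i ∈ Finset.range n, {y | c y ≠ w (k + i)}.indicator (1 : X → ℝ) (T^[i] z) ≤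
        mismatch T c w h k z :=
      Finset.sum_le_sum_of_subset_of_nonneg (Finset.range_mono (by omega))
        fun _ _ _ => indicator_one_nonneg _ _
    have e2 : ∑ i ∈ Finset.range n, (if w (k + i) ≠ w (k + l + i) then (1 : ℝ) else 0) ≤
        ∑ i ∈ Finset.range n, {y | c y ≠ w (k + i)}.indicator (1 : X → ℝ) (T^[i] z) +
        ∑ i ∈ Finset.range n, {y | c y ≠ w (k + l + i)}.indicator (1 : X → ℝ) (T^[i] z) := by
      rw [← Finset.sum_add_distrib]
      refine Finset.sum_le_sum fun i _ => ?_
      simp only [Set.indicator_apply, Set.mem_ofPred_eq, Pi.one_apply]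
      split_ifs <;> grind
    have e3 : mismatch T c w h k z ≤ r := h1
    have e4 : mismatch T c w h (k + l) z ≤ r := h2
    have e5 : mismatch T c w h (k + l) z =
      ∑ i ∈ Finset.range n, {y | c y ≠ w (k + l + i)}.indicator (1 : X → ℝ) (T^[i] z) := rfl
    linarith
  have hcol : μ.real {x | x ∈ column T B k (h - l) ∧ c (T^[l] x) ≠ c x} =
      ∑ i ∈ Finset.range n, μ.real (T^[k + i] '' B ∩ {x | c (T^[l] x) ≠ c x}) := by
    have := measureReal_column_inter T hB (a := k) (b := h - l) (by omega) hD
    rw [Finset.sum_Ico_eq_sum_range, show h - l - k = n by omega] at this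
    exact this
  rw [hcol]
  -- If the letters of levels k+i and k+l+i agree, a change of code under T^l is a reading error on
  -- one of the two levels; if they differ, the whole level is given up.
  have hterm : ∀ i ∈ Finset.range n, μ.real (T^[k + i] '' B ∩ {x | c (T^[l] x) ≠ c x}) ≤
      μ.real (T^[k + i] '' B ∩ {y | c y ≠ w (k + i)}) +
      μ.real (T^[k + l + i] '' B ∩ {y | c y ≠ w (k + l + i)}) +
      (if w (k + i) ≠ w (k + l + i) then (1 : ℝ) else 0) * μ.real B := by
    intro i _
    have s1 : μ.real (T^[k + l + i] '' B ∩ {y | c y ≠ w (k + l + i)}) =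
        μ.real (T^[k + i] '' B ∩ T^[l] ⁻¹' {y | c y ≠ w (k + l + i)}) := by
      rw [measureReal_level_inter T hBm (measurableSet_ne hc _),
        show k + i + l = k + l + i by omega]
    rw [s1]
    split_ifs with hw
    · have : μ.real (T^[k + i] '' B ∩ {x | c (T^[l] x) ≠ c x}) ≤ μ.real B := by
        rw [← measureReal_level T hBm (k + i)]
        exact measureReal_mono Set.inter_subset_left
      have p1 : 0 ≤ μ.real (T^[k + i] '' B ∩ {y | c y ≠ w (k + i)}) := measureReal_nonneg
      have p2 : 0 ≤ μ.real (T^[k + i] '' B ∩ T^[l] ⁻¹' {y | c y ≠ w (k + l + i)}) :=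
        measureReal_nonneg
      linarith
    · rw [ne_eq, not_not] at hw
      rw [zero_mul, add_zero]
      refine (measureReal_mono ?_).trans (measureReal_union_le _ _)
      rintro x ⟨hx, hne⟩
      by_cases hcx : c x = w (k + i)
      · refine Or.inr ⟨hx, fun h' => hne ?_⟩
        rw [hcx, hw]
        exact h'
      · exact Or.inl ⟨hx, hcx⟩
  refine (Finset.sum_le_sum hterm).trans ?_
  rw [Finset.sum_add_distrib, Finset.sum_add_distrib, ← Finset.sum_mul]
  have t1 := sum_comp_add_le_towerError (μ := μ) T c w B (show k + n ≤ h by omega)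
  have t2 := sum_comp_add_le_towerError (μ := μ) T c w B (show k + l + n ≤ h by omega)
  have t3 := mul_le_mul_of_nonneg_right hcount (measureReal_nonneg (μ := μ) (s := B))
  linarith

/-- In the absence of almost periodicity, the sets of points following the name of a tower from
different levels are disjoint, hence small. -/
lemma mul_measureReal_follows_le_one (T : Aut μ) {c : X → ι} (hc : Measurable c) (w : ℕ → ι)
    {B : Set X} {h : ℕ} (hB : IsTower T B h) (r : ℝ) {δ β : ℝ} {K : ℕ} (hK : 2 * K ≤ h)
    (hrig : ∀ l ≥ 1, ∀ U : Set X, MeasurableSet U → β - δ ≤ μ.real U →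
      μ.real (symmDiff (T ⁻¹' U) U) ≤ δ → δ ≤ μ.real {x | x ∈ U ∧ c (T^[l] x) ≠ c x})
    (herr : 2 * towerError μ T c w B h + 2 * r * μ.real B < δ)
    (hBδ : 2 * μ.real B ≤ δ) (hmass : β - δ ≤ (h - 2 * K : ℕ) * μ.real B) :
    K * μ.real (follows T c w h r K) ≤ 1 := by
  set E := follows T c w h r with hE
  -- A common point would contradict `hrig` on the column of levels from k to h - l - 1; as k + l ≤
  -- 2K, it keeps at least h - 2K levels, enough for `hmass`.
  have hdisj : ∀ k l, 1 ≤ l → k + l ≤ 2 * K → Disjoint (E k) (E (k + l)) := by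
    intro k l hl hkl
    rw [Set.disjoint_left]
    intro z h1 h2
    have := measureReal_column_shift_le T hc w hB r (by omega) h1 h2
    have hU := hrig l hl (column T B k (h - l)) (measurableSet_column T hB.measurableSet _ _) ?_
      ((measureReal_symmDiff_column_le T hB.measurableSet _ _).trans hBδ)
    · linarith
    · rw [measureReal_column T hB (by omega)]
      refine hmass.trans (mul_le_mul_of_nonneg_right ?_ measureReal_nonneg)
      exact_mod_cast (show h - 2 * K ≤ h - l - k by omega)
  have hmono : ∀ j, j ≤ K → μ.real (E K) ≤ μ.real (E (K + j)) := by
    intro j hj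
    induction j with
    | zero => rfl
    | succ j ih =>
      refine (ih (by omega)).trans ?_
      by_cases hlt : K + j < h
      · exact measureReal_follows_mono T hc w r hlt
      · omega
  calc K * μ.real (E K) = ∑ j ∈ Finset.range K, μ.real (E K) := by simp
    _ ≤ ∑ j ∈ Finset.range K, μ.real (E (K + j)) :=
        Finset.sum_le_sum fun j hj => hmono j (Finset.mem_range.1 hj).le
    _ = μ.real (⋃ j ∈ Finset.range K, E (K + j)) := by
        rw [measureReal_biUnion_finset]
        · intro i hi j hj hij
          have hi := Finset.mem_range.1 hi
          have hj := Finset.mem_range.1 hj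
          rcases lt_or_gt_of_ne hij with h | h
          · have := hdisj (K + i) (j - i) (by omega) (by omega)
            rwa [show K + i + (j - i) = K + j by omega] at this
          · have := hdisj (K + j) (i - j) (by omega) (by omega)
            rw [show K + j + (i - j) = K + i by omega] at this
            exact this.symm
        · exact fun j _ => measurableSet_follows T hc w h r _
    _ ≤ 1 := measureReal_le_one

/-- T^i carries level k onto level k+i, so the integral is the sum of the reading errors on the
levels from k up. -/
lemma setIntegral_level_mismatch_le (T : Aut μ) {c : X → ι} (hc : Measurable c) (w : ℕ → ι)
    {B : Set X} (hB : MeasurableSet B) {h k : ℕ} (hk : k ≤ h) :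
    ∫ z in T^[k] '' B, mismatch T c w h k z ∂μ ≤ towerError μ T c w B h := by
  have hm : ∀ i, MeasurableSet (T^[i] ⁻¹' {y | c y ≠ w (k + i)}) := fun i =>
    measurableSet_iterate_preimage T (measurableSet_ne hc _) i
  have e : ∀ z, mismatch T c w h k z = ∑ i ∈ Finset.range (h - k),
      (T^[i] ⁻¹' {y | c y ≠ w (k + i)}).indicator (1 : X → ℝ) z := fun z => rfl
  simp only [e]
  rw [integral_finsetSum]
  · simp only [integral_indicator_one' (hm _), measureReal_level_inter T hB (measurableSet_ne hc _)]
    exact sum_comp_add_le_towerError T c w B (by omega)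
  · exact fun i _ => ((integrable_const (1 : ℝ)).indicator (hm i)).integrableOn

/-- An automorphism that almost preserves names moves few points of the bottom of the tower. -/
lemma measureReal_column_inter_ne_le (T S : Aut μ) {c : X → ι} (hc : Measurable c) (w : ℕ → ι)
    {B A : Set X} {h : ℕ} (hB : IsTower T B h) {r δ β γ : ℝ} (hr : 0 < r) {K : ℕ} (hK0 : 0 < K)
    (hK : 2 * K ≤ h)
    (hrig : ∀ l ≥ 1, ∀ U : Set X, MeasurableSet U → β - δ ≤ μ.real U →
      μ.real (symmDiff (T ⁻¹' U) U) ≤ δ → δ ≤ μ.real {x | x ∈ U ∧ c (T^[l] x) ≠ c x})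
    (herr : 2 * towerError μ T c w B h + 2 * r * μ.real B < δ)
    (hBδ : 2 * μ.real B ≤ δ) (hmass : β - δ ≤ (h - 2 * K : ℕ) * μ.real B)
    (hS : ∑ i ∈ Finset.range h, μ.real {y | c (T^[i] (S y)) ≠ c (T^[i] y)} ≤ γ) :
    μ.real (column T B 0 K ∩ A) ≤ 2 / r * γ + 2 / r * (K * towerError μ T c w B h) +
      2 * (r / K) + μ.real {y | y ∈ A ∧ c (S y) = c y} := by
  set E := follows T c w h r
  set τ := towerError μ T c w B h
  have hBm := hB.measurableSet
  have hne : ∀ i, MeasurableSet {y | c (T^[i] (S y)) ≠ c (T^[i] y)} := fun i =>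
    (measurableSet_eq_fun (hc.comp ((T.1.measurable.iterate i).comp S.1.measurable))
      (hc.comp (T.1.measurable.iterate i))).compl
  set q : X → ℝ := fun y =>
    ∑ i ∈ Finset.range h, {y | c (T^[i] (S y)) ≠ c (T^[i] y)}.indicator (1 : X → ℝ) y
  have hqi : ∀ i ∈ Finset.range h,
      Integrable ({y | c (T^[i] (S y)) ≠ c (T^[i] y)}.indicator (1 : X → ℝ)) μ := fun i _ =>
    (integrable_const (1 : ℝ)).indicator (hne i)
  -- The allowance r is halved: r/2 for the letters changed by S (exceptional set `G`) and r/2 for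
  -- the errors of y itself (exceptional set `D`). Outside both, y and S y lie in E_k; both sets are
  -- small by Markov's inequality.
  set G := {y | r / 2 ≤ q y}
  have hG : μ.real G ≤ 2 / r * γ := by
    have m := mul_meas_ge_le_integral_of_nonneg (μ := μ) (f := q)
      (Eventually.of_forall fun y => Finset.sum_nonneg fun _ _ => indicator_one_nonneg _ _)
      (integrable_finsetSum _ hqi) (r / 2)
    have e : ∫ y, q y ∂μ = ∑ i ∈ Finset.range h, μ.real {y | c (T^[i] (S y)) ≠ c (T^[i] y)} := by
      rw [integral_finsetSum _ hqi]
      exact Finset.sum_congr rfl fun i _ => integral_indicator_one (hne i)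
    rw [e] at m
    have m2 : r / 2 * μ.real G ≤ γ := m.trans hS
    rw [div_mul_eq_mul_div, le_div_iff₀ hr]
    linarith
  set D := ⋃ k ∈ Finset.range K, (T^[k] '' B ∩ {y | r / 2 ≤ mismatch T c w h k y})
  have hD : μ.real D ≤ 2 / r * (K * τ) := by
    have each : ∀ k ∈ Finset.range K,
        μ.real (T^[k] '' B ∩ {y | r / 2 ≤ mismatch T c w h k y}) ≤ 2 / r * τ := by
      intro k hk
      have hkh : k ≤ h := by have := Finset.mem_range.1 hk; omega
      have m := mul_meas_ge_le_integral_of_nonneg (μ := μ.restrict (T^[k] '' B))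
        (f := mismatch T c w h k) (Eventually.of_forall fun y => mismatch_nonneg ..)
        (integrable_mismatch T hc w h k).integrableOn (r / 2)
      rw [measureReal_restrict_apply
        (measurableSet_le measurable_const (measurable_mismatch T hc w h k)), Set.inter_comm] at m
      have := m.trans (setIntegral_level_mismatch_le T hc w hBm hkh)
      rw [div_mul_eq_mul_div, le_div_iff₀ hr]
      linarith
    calc μ.real D ≤ ∑ k ∈ Finset.range K,
          μ.real (T^[k] '' B ∩ {y | r / 2 ≤ mismatch T c w h k y}) :=
          measureReal_biUnion_finset_le _ _
      _ ≤ ∑ k ∈ Finset.range K, 2 / r * τ := Finset.sum_le_sum each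
      _ = 2 / r * (K * τ) := by simp; ring
  -- Points that follow the name from some level but start with a wrong letter. Excluding both `Z`
  -- and its preimage under S forces c(y) = w k = c(S y).
  set Z := ⋃ k ∈ Finset.range K, (E k ∩ {y | c y ≠ w k})
  have hZm : MeasurableSet Z := Finset.measurableSet_biUnion _ fun k _ =>
    (measurableSet_follows T hc w h r k).inter (measurableSet_ne hc _)
  have hZ : μ.real Z ≤ r / K := by
    have h1 := mul_measureReal_follows_le_one T hc w hB r hK hrig herr hBδ hmass
    have h2 := sum_measureReal_follows_inter_ne_le (μ := μ) T hc w r (show K ≤ h by omega)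
    have h3 : μ.real Z ≤ r * μ.real (E K) := (measureReal_biUnion_finset_le _ _).trans h2
    have hKp : (0 : ℝ) < K := by exact_mod_cast hK0
    rw [le_div_iff₀ hKp]
    calc μ.real Z * K ≤ r * μ.real (E K) * K := by gcongr
      _ = r * (K * μ.real (E K)) := by ring
      _ ≤ r * 1 := by gcongr
      _ = r := mul_one r
  have hSZ : μ.real (S ⁻¹' Z) ≤ r / K := by
    rw [S.2.measureReal_preimage hZm.nullMeasurableSet]
    exact hZ
  have hcover : column T B 0 K ∩ A ⊆
      G ∪ (D ∪ (Z ∪ (S ⁻¹' Z ∪ {y | y ∈ A ∧ c (S y) = c y}))) := by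
    rintro y ⟨hy, hyA⟩
    simp only [column, Set.mem_iUnion, Finset.mem_Ico] at hy
    obtain ⟨k, ⟨-, hkK⟩, hyk⟩ := hy
    by_contra hcon
    simp only [Set.mem_union, not_or] at hcon
    obtain ⟨nG, nD, nZ, nSZ, nA⟩ := hcon
    have i1 : q y < r / 2 := not_le.1 nG
    have i2 : mismatch T c w h k y < r / 2 := by
      by_contra hge
      exact nD (Set.mem_biUnion (Finset.mem_coe.2 (Finset.mem_range.2 hkK)) ⟨hyk, not_lt.1 hge⟩)
    have i3 : mismatch T c w h k (S y) ≤ mismatch T c w h k y + q y := by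
      have : mismatch T c w h k (S y) ≤ mismatch T c w h k y + ∑ i ∈ Finset.range (h - k),
          {y | c (T^[i] (S y)) ≠ c (T^[i] y)}.indicator (1 : X → ℝ) y := by
        unfold mismatch
        rw [← Finset.sum_add_distrib]
        refine Finset.sum_le_sum fun i _ => ?_
        classical
        simp only [Set.indicator_apply, Set.mem_ofPred_eq, Pi.one_apply]
        by_cases a1 : c (T^[i] (S y)) = c (T^[i] y)
        · simp [a1]
        · simp only [a1, not_false_eq_true, ne_eq, if_true]
          split_ifs <;> norm_num
      refine this.trans (add_le_add_right ?_ _)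
      exact Finset.sum_le_sum_of_subset_of_nonneg (Finset.range_mono (by omega))
        fun _ _ _ => indicator_one_nonneg _ _
    have yE : y ∈ E k := show mismatch T c w h k y ≤ r by linarith
    have SyE : S y ∈ E k := show mismatch T c w h k (S y) ≤ r by linarith
    have hkr : k ∈ (↑(Finset.range K) : Set ℕ) := Finset.mem_coe.2 (Finset.mem_range.2 hkK)
    have cy : c y = w k := by
      by_contra hne
      exact nZ (Set.mem_biUnion hkr ⟨yE, hne⟩)
    have cSy : c (S y) = w k := by
      by_contra hne
      exact nSZ (Set.mem_biUnion hkr ⟨SyE, hne⟩)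
    exact nA ⟨hyA, cSy.trans cy.symm⟩
  have u1 := measureReal_mono (μ := μ) hcover
  have u2 := measureReal_union_le (μ := μ) G
    (D ∪ (Z ∪ (S ⁻¹' Z ∪ {y | y ∈ A ∧ c (S y) = c y})))
  have u3 := measureReal_union_le (μ := μ) D (Z ∪ (S ⁻¹' Z ∪ {y | y ∈ A ∧ c (S y) = c y}))
  have u4 := measureReal_union_le (μ := μ) Z (S ⁻¹' Z ∪ {y | y ∈ A ∧ c (S y) = c y})
  have u5 := measureReal_union_le (μ := μ) (S ⁻¹' Z) {y | y ∈ A ∧ c (S y) = c y}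
  linarith

end TowerNames

/-! ### A refining sequence of finite partitions -/

section Code

variable {X : Type*} [MeasurableSpace X] [MeasurableSpace.CountablyGenerated X]

/-- The first `n` binary digits of a point, with respect to a generating sequence of sets. -/
noncomputable def code (n : ℕ) (x : X) : Fin n → Bool := fun s => MeasurableSpace.mapNatBool X x s

lemma measurable_code (n : ℕ) : Measurable (code n : X → Fin n → Bool) :=
  measurable_pi_iff.2 fun s =>
    (measurable_pi_iff.1 (MeasurableSpace.measurable_mapNatBool (α := X))) s

lemma code_eq_of_le {m n : ℕ} (hmn : m ≤ n) {x y : X} (h : code n x = code n y) :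
    code m x = code m y :=
  funext fun s => congrFun h (Fin.castLE hmn s)

lemma eq_of_forall_code_eq [MeasurableSpace.SeparatesPoints X] {x y : X}
    (h : ∀ n, code n x = code n y) : x = y :=
  MeasurableSpace.injective_mapNatBool X
    (funext fun s => congrFun (h (s + 1)) ⟨s, Nat.lt_succ_self s⟩)

lemma setOf_eq_eq_iInter_code [MeasurableSpace.SeparatesPoints X] {Y : Type*} (f g : Y → X) :
    {y | f y = g y} = ⋂ n, {y | code n (f y) = code n (g y)} := by
  ext y
  simp only [Set.mem_iInter, Set.mem_ofPred_eq]
  exact ⟨fun h n => by rw [h], eq_of_forall_code_eq⟩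

lemma measurableSet_setOf_eq [MeasurableSpace.SeparatesPoints X] {Y : Type*} [MeasurableSpace Y]
    {f g : Y → X} (hf : Measurable f) (hg : Measurable g) : MeasurableSet {y | f y = g y} := by
  rw [setOf_eq_eq_iInter_code]
  exact MeasurableSet.iInter fun n => measurableSet_eq_fun
    ((measurable_code n).comp hf) ((measurable_code n).comp hg)

lemma tendsto_measureReal_code_eq [MeasurableSpace.SeparatesPoints X] {Y : Type*}
    [MeasurableSpace Y] (ν : Measure Y) [IsFiniteMeasure ν] {f g : Y → X} (hf : Measurable f)
    (hg : Measurable g) {D : Set Y} (hD : MeasurableSet D) :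
    Tendsto (fun n => ν.real {y | y ∈ D ∧ code n (f y) = code n (g y)}) atTop
      (𝓝 (ν.real {y | y ∈ D ∧ f y = g y})) := by
  have e : {y | y ∈ D ∧ f y = g y} = ⋂ n, {y | y ∈ D ∧ code n (f y) = code n (g y)} := by
    change D ∩ {y | f y = g y} = ⋂ n, D ∩ {y | code n (f y) = code n (g y)}
    rw [setOf_eq_eq_iInter_code, Set.inter_iInter]
  rw [e]
  refine (ENNReal.tendsto_toReal (measure_ne_top ν _)).comp (tendsto_measure_iInter_atTop
    (fun n => (hD.inter (measurableSet_eq_fun ((measurable_code n).comp hf)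
      ((measurable_code n).comp hg))).nullMeasurableSet)
    (fun m n hmn y hy => ⟨hy.1, code_eq_of_le hmn hy.2⟩) ⟨0, measure_ne_top ν _⟩)

/-- The pairs with equal code decrease to the diagonal, which is null for the product of a
non-atomic measure; a code class of measure p contributes p² to the measure of these pairs. -/
lemma exists_measureReal_code_preimage_le [MeasurableSpace.SeparatesPoints X] (μ : Measure X)
    [IsProbabilityMeasure μ] [NullSingletonClass μ] {η : ℝ} (hη : 0 < η) :
    ∃ n₀, ∀ n ≥ n₀, ∀ a : Fin n → Bool, μ.real (code n ⁻¹' {a}) ≤ η := by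
  have h := tendsto_measureReal_code_eq (X := X) (μ.prod μ) measurable_fst measurable_snd
    MeasurableSet.univ
  have h0 : (μ.prod μ).real {p | p ∈ Set.univ ∧ p.1 = p.2} = 0 := by
    have hm : MeasurableSet {p : X × X | p ∈ Set.univ ∧ p.1 = p.2} :=
      MeasurableSet.univ.inter (measurableSet_setOf_eq measurable_fst measurable_snd)
    rw [measureReal_eq_zero_iff, Measure.prod_apply hm]
    refine (lintegral_congr fun x => ?_).trans lintegral_zero
    have : Prod.mk x ⁻¹' {p : X × X | p ∈ Set.univ ∧ p.1 = p.2} = {x} := by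
      ext y
      simp [eq_comm]
    rw [this, measure_singleton]
  rw [h0] at h
  obtain ⟨n₀, hn₀⟩ := eventually_atTop.1 (h.eventually_lt_const (by positivity : 0 < η ^ 2))
  refine ⟨n₀, fun n hn a => ?_⟩
  have h1 : μ.real (code n ⁻¹' {a}) ^ 2 ≤ η ^ 2 := by
    refine le_trans ?_ (hn₀ n hn).le
    rw [sq, ← measureReal_prod_prod]
    refine measureReal_mono ?_
    rintro ⟨x, y⟩ ⟨hx, hy⟩
    exact ⟨trivial, Eq.trans hx (Eq.symm hy)⟩
  exact (sq_le_sq₀ measureReal_nonneg hη.le).1 h1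

end Code

/-! ### Towers from the local rank -/

section LocalRank

variable {X : Type*} [MeasurableSpace X] {μ : Measure X} [IsProbabilityMeasure μ]

lemma IsTower.mul_measureReal_le_one {T : Aut μ} {B : Set X} {h : ℕ} (hB : IsTower T B h) :
    h * μ.real B ≤ 1 := by
  have := measureReal_column T hB (a := 0) le_rfl
  rw [Nat.sub_zero] at this
  rw [← this]
  exact measureReal_le_one

lemma _root_.TowerPartition.isTower {T : Aut μ} (ξ : TowerPartition T) :
    IsTower T ξ.base ξ.height :=
  ⟨ξ.measurableSet_base, ξ.disjoint_level⟩

lemma _root_.TowerPartition.tower_eq_column {T : Aut μ} (ξ : TowerPartition T) :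
    ξ.tower = column T ξ.base 0 ξ.height := by
  ext x
  simp [TowerPartition.tower, column]

lemma _root_.TowerPartition.IsMeasurable.measurableSet {T : Aut μ} {ξ : TowerPartition T} {A : Set X}
    (hA : ξ.IsMeasurable A) : MeasurableSet A := by
  obtain ⟨𝒜, h𝒜, rfl⟩ := hA
  have hc : ξ.atoms.Countable := by
    refine Set.Countable.union ?_ (Set.countable_range _)
    refine (Set.countable_range fun k => T^[k] '' ξ.base).mono ?_
    rintro E ⟨k, -, rfl⟩
    exact ⟨k, rfl⟩
  refine MeasurableSet.sUnion (hc.mono h𝒜) fun E hE => ?_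
  rcases h𝒜 hE with ⟨k, -, rfl⟩ | ⟨l, rfl⟩
  · exact measurableSet_level T ξ.measurableSet_base k
  · exact ξ.measurableSet_rest l

lemma _root_.TowerPartition.IsMeasurable.level_subset_or_disjoint {T : Aut μ} {ξ : TowerPartition T}
    {A : Set X} (hA : ξ.IsMeasurable A) {k : ℕ} (hk : k < ξ.height) :
    T^[k] '' ξ.base ⊆ A ∨ Disjoint (T^[k] '' ξ.base) A := by
  obtain ⟨𝒜, h𝒜, rfl⟩ := hA
  by_cases hmem : T^[k] '' ξ.base ∈ 𝒜
  · exact Or.inl (Set.subset_sUnion_of_mem hmem)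
  · right
    rw [Set.disjoint_sUnion_right]
    intro E hE
    rcases h𝒜 hE with ⟨i, hi, rfl⟩ | ⟨l, rfl⟩
    · refine ξ.disjoint_level k hk i hi ?_
      rintro rfl
      exact hmem hE
    · exact ξ.disjoint_level_rest k hk l

/-- Give a level the letter of an approximating set that contains it. If there is none, the level is
disjoint from every approximating set, so each of its points x is already an error of approximation
for the class c x; the letter is then arbitrary. -/
lemma _root_.TowerPartition.exists_towerError_le {ι : Type*} [Fintype ι] [Nonempty ι] [MeasurableSpace ι]
    [MeasurableSingletonClass ι] {T : Aut μ} (ξ : TowerPartition T) {c : X → ι}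
    (hc : Measurable c) (A : ι → Set X) (hA : ∀ a, ξ.IsMeasurable (A a)) :
    ∃ w : ℕ → ι, towerError μ T c w ξ.base ξ.height ≤
      ∑ a, μ.real (symmDiff (c ⁻¹' {a}) (A a)) := by
  classical
  set w : ℕ → ι := fun k =>
    if h : ∃ a, T^[k] '' ξ.base ⊆ A a then h.choose else Classical.arbitrary ι with hw
  have hm : ∀ a, MeasurableSet (symmDiff (c ⁻¹' {a}) (A a)) := fun a =>
    (hc (measurableSet_singleton a)).symmDiff (hA a).measurableSet
  refine ⟨w, ?_⟩
  have each : ∀ k ∈ Finset.range ξ.height, μ.real (T^[k] '' ξ.base ∩ {y | c y ≠ w k}) ≤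
      ∑ a, μ.real (T^[k] '' ξ.base ∩ symmDiff (c ⁻¹' {a}) (A a)) := by
    intro k hk
    by_cases h : ∃ a, T^[k] '' ξ.base ⊆ A a
    · have hwk : T^[k] '' ξ.base ⊆ A (w k) := by
        rw [hw]
        simp only [dif_pos h]
        exact h.choose_spec
      refine le_trans (measureReal_mono ?_) (Finset.single_le_sum
        (f := fun a => μ.real (T^[k] '' ξ.base ∩ symmDiff (c ⁻¹' {a}) (A a)))
        (fun _ _ => measureReal_nonneg) (Finset.mem_univ (w k)))
      rintro x ⟨hx, hne⟩
      exact ⟨hx, Or.inr ⟨hwk hx, hne⟩⟩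
    · refine le_trans (measureReal_mono ?_) (measureReal_iUnion_fintype_le _)
      rintro x ⟨hx, -⟩
      refine Set.mem_iUnion.2 ⟨c x, hx, Or.inl ⟨rfl, fun hxA => ?_⟩⟩
      rcases (hA (c x)).level_subset_or_disjoint (Finset.mem_range.1 hk) with h1 | h1
      · exact h ⟨_, h1⟩
      · exact Set.disjoint_left.1 h1 hx hxA
  refine (Finset.sum_le_sum each).trans ?_
  rw [Finset.sum_comm]
  refine Finset.sum_le_sum fun a _ => ?_
  have := measureReal_column_inter T ξ.isTower (a := 0) le_rfl (hm a)
  rw [← Finset.range_eq_Ico] at this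
  rw [← this]
  exact measureReal_mono Set.inter_subset_right

lemma exists_tower_of_hasApproximatingPartitions {ι : Type*} [Fintype ι] [MeasurableSpace ι]
    [MeasurableSingletonClass ι] {T : Aut μ} {β : ℝ} (hβ : HasApproximatingPartitions μ T β)
    {c : X → ι} (hc : Measurable c) {η : ℝ} (hη : 0 < η) :
    ∃ (B : Set X) (h : ℕ) (w : ℕ → ι), IsTower T B h ∧ β - η ≤ h * μ.real B ∧
      towerError μ T c w B h ≤ η := by
  have : Nonempty ι := (nonempty_of_isProbabilityMeasure μ).map c
  obtain ⟨ξ, happ, hlim⟩ := hβ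
  choose A hA hAlim using fun a : ι => happ (c ⁻¹' {a}) (hc (measurableSet_singleton a))
  have l1 : Tendsto (fun j => ∑ a, μ.real (symmDiff (c ⁻¹' {a}) (A a j))) atTop (𝓝 0) := by
    have : Tendsto (fun j => ∑ a, μ.real (symmDiff (c ⁻¹' {a}) (A a j))) atTop
        (𝓝 (∑ a : ι, (0 : ℝ))) := tendsto_finsetSum _ fun a _ =>
      (ENNReal.tendsto_toReal ENNReal.zero_ne_top).comp (hAlim a)
    simpa using this
  obtain ⟨j, h1, h2⟩ := ((l1.eventually_lt_const hη).and
    (hlim.eventually_const_lt (sub_lt_self β hη))).exists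
  obtain ⟨w, hw⟩ := (ξ j).exists_towerError_le hc (fun a => A a j) fun a => hA a j
  refine ⟨(ξ j).base, (ξ j).height, w, (ξ j).isTower, ?_, hw.trans h1.le⟩
  rw [TowerPartition.tower_eq_column, measureReal_column T (ξ j).isTower le_rfl, Nat.sub_zero] at h2
  exact h2.le

lemma _root_.HasApproximatingPartitions.le_one {T : Aut μ} {β : ℝ}
    (hβ : HasApproximatingPartitions μ T β) : β ≤ 1 := by
  obtain ⟨ξ, -, hlim⟩ := hβ
  exact le_of_tendsto' hlim fun j => measureReal_le_one

lemma localRank_le_one (T : Aut μ) : localRank μ T ≤ 1 :=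
  Real.sSup_le (fun _ h => HasApproximatingPartitions.le_one h.2) zero_le_one

/-- Only values close to the supremum are needed, so no attainment of the local rank is required. -/
lemma exists_tower {ι : Type*} [Fintype ι] [MeasurableSpace ι] [MeasurableSingletonClass ι]
    {T : Aut μ} (hβ : 0 < localRank μ T) {c : X → ι} (hc : Measurable c) {η : ℝ} (hη : 0 < η) :
    ∃ (B : Set X) (h : ℕ) (w : ℕ → ι), IsTower T B h ∧ localRank μ T - η ≤ h * μ.real B ∧
      towerError μ T c w B h ≤ η := by
  have hne : {β | 0 < β ∧ HasApproximatingPartitions μ T β}.Nonempty := by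
    by_contra hne
    rw [Set.not_nonempty_iff_eq_empty] at hne
    rw [localRank, hne, Real.sSup_empty] at hβ
    exact lt_irrefl _ hβ
  obtain ⟨β, ⟨-, h1⟩, h2⟩ := exists_lt_of_lt_csSup hne
    (show localRank μ T - η / 2 < _ from sub_lt_self _ (half_pos hη))
  obtain ⟨B, h, w, hB, h3, h4⟩ := exists_tower_of_hasApproximatingPartitions h1 hc (half_pos hη)
  exact ⟨B, h, w, hB, by linarith, by linarith⟩

/-- By Poincaré recurrence an atom would return to itself and be a periodic point of positive
measure. -/
lemma noAtoms_of_aperiodic [MeasurableSingletonClass X] (T : Aut μ)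
    (hT : ∀ l ≥ 1, μ.real {x | T^[l] x = x} = 0) : NullSingletonClass μ := by
  refine ⟨fun x => ?_⟩
  by_contra hx
  obtain ⟨y, hy, m, hm, hmy⟩ := T.2.conservative.exists_mem_iterate_mem
    (measurableSet_singleton x).nullMeasurableSet hx
  rw [Set.mem_singleton_iff] at hy hmy
  subst hy
  have h0 := hT m (Nat.one_le_iff_ne_zero.2 hm)
  rw [measureReal_eq_zero_iff] at h0
  exact hx (measure_mono_null (t := {x | T^[m] x = x}) (Set.singleton_subset_iff.2 hmy) h0)

lemma exists_high_tower [StandardBorelSpace X] [NullSingletonClass μ] {T : Aut μ} (hβ : 0 < localRank μ T)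
    (n H : ℕ) {η : ℝ} (hη : 0 < η) :
    ∃ (B : Set X) (h : ℕ) (w : ℕ → Fin n → Bool), IsTower T B h ∧ H ≤ h ∧
      localRank μ T - η ≤ h * μ.real B ∧ towerError μ T (code n) w B h ≤ η := by
  set β := localRank μ T
  -- The base is covered by its reading errors and one code class, each of at most this measure. A
  -- tower of height below H would then have measure at most β/4, less than the guaranteed 7β/8.
  -- Passing to the first n digits of the letters afterwards only lowers the error.
  have hη1 : 0 < β / 8 / (H + 1) := by positivity
  obtain ⟨n₀, hn₀⟩ := exists_measureReal_code_preimage_le μ hη1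
  have hn : n ≤ max n n₀ := le_max_left _ _
  set η' := min η (β / 8 / (H + 1))
  have hη' : 0 < η' := lt_min hη hη1
  have hle1 : η' ≤ β / 8 / (H + 1) := min_le_right _ _
  obtain ⟨B, h, w, hB, h1, h2⟩ := exists_tower hβ (measurable_code (X := X) (max n n₀)) hη'
  refine ⟨B, h, fun k s => w k (Fin.castLE hn s), hB, ?_, ?_, ?_⟩
  · by_contra hlt
    rw [not_le] at hlt
    have hβ8 : β / 8 / (H + 1) ≤ β / 8 := div_le_self (by positivity) (by linarith [H.cast_nonneg (α := ℝ)])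
    have hh : 0 < h := by
      rcases Nat.eq_zero_or_pos h with rfl | hpos
      · simp only [Nat.cast_zero, zero_mul] at h1
        linarith
      · exact hpos
    have b1 : μ.real (B ∩ {y | code (max n n₀) y ≠ w 0}) ≤ η' := by
      refine le_trans ?_ h2
      have := Finset.single_le_sum
        (f := fun k => μ.real (T^[k] '' B ∩ {y | code (max n n₀) y ≠ w k}))
        (fun _ _ => measureReal_nonneg) (Finset.mem_range.2 hh)
      simpa [towerError] using this
    have b2 := hn₀ _ (le_max_right n n₀) (w 0)
    have b3 : μ.real B ≤ 2 * (β / 8 / (H + 1)) := by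
      have hsub : B ⊆ (B ∩ {y | code (max n n₀) y ≠ w 0}) ∪ code (max n n₀) ⁻¹' {w 0} := by
        intro x hx
        by_cases hxw : code (max n n₀) x = w 0
        · exact Or.inr hxw
        · exact Or.inl ⟨hx, hxw⟩
      have := (measureReal_mono (μ := μ) hsub).trans (measureReal_union_le _ _)
      linarith
    have b4 : h * μ.real B ≤ (H + 1) * (2 * (β / 8 / (H + 1))) := by
      have : (h : ℝ) ≤ H + 1 := by exact_mod_cast hlt.le.trans (Nat.le_succ H)
      gcongr
    have b5 : ((H : ℝ) + 1) * (2 * (β / 8 / (H + 1))) = β / 4 := by field_simp; ring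
    linarith
  · exact le_trans (sub_le_sub_left (min_le_left _ _) _) h1
  · refine le_trans (Finset.sum_le_sum fun k _ => measureReal_mono ?_) (h2.trans (min_le_left _ _))
    rintro x ⟨hx, hne⟩
    refine ⟨hx, fun he => hne ?_⟩
    funext s
    exact congrFun he (Fin.castLE hn s)

end LocalRank

/-! ### Sequential compactness in the weak operator topology -/

section WeakOperator

variable {E : Type*} [NormedAddCommGroup E] [InnerProductSpace ℝ E]

lemma cauchySeq_inner_of_dense {s : Set E} (hs : Dense s) {x : ℕ → E} {C : ℝ}
    (hx : ∀ i, ‖x i‖ ≤ C) (h : ∀ e ∈ s, CauchySeq fun i => inner ℝ (x i) e) (g : E) :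
    CauchySeq fun i => inner ℝ (x i) g := by
  have hC : 0 ≤ C := (norm_nonneg _).trans (hx 0)
  rw [Metric.cauchySeq_iff]
  intro ε hε
  obtain ⟨e, he, hge⟩ := hs.exists_dist_lt g (show 0 < ε / 3 / (C + 1) by positivity)
  obtain ⟨N, hN⟩ := Metric.cauchySeq_iff.1 (h e he) (ε / 3) (by positivity)
  have hb : ∀ i, |inner ℝ (x i) g - inner ℝ (x i) e| ≤ ε / 3 := fun i => by
    rw [← inner_sub_right]
    refine (abs_real_inner_le_norm _ _).trans ?_
    rw [dist_eq_norm] at hge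
    calc ‖x i‖ * ‖g - e‖ ≤ (C + 1) * (ε / 3 / (C + 1)) := by
          gcongr
          exact (hx i).trans (le_add_of_nonneg_right zero_le_one)
      _ = ε / 3 := by field_simp
  refine ⟨N, fun m hm n hn => ?_⟩
  have h1 := hN m hm n hn
  rw [Real.dist_eq] at h1 ⊢
  have h2 := hb m
  have h3 := hb n
  rw [abs_le] at h2 h3
  rw [abs_lt] at h1 ⊢
  constructor <;> linarith

/-- A sequence of contractions of a separable Hilbert space has a subsequence that converges in the
weak operator topology. -/
lemma exists_subseq_weakOperator_tendsto [CompleteSpace E] [TopologicalSpace.SeparableSpace E]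
    (V : ℕ → E →L[ℝ] E) (hV : ∀ i f, ‖V i f‖ ≤ ‖f‖) :
    ∃ φ : ℕ → ℕ, StrictMono φ ∧ ∃ Q : E →L[ℝ] E, ∀ f g,
      Tendsto (fun i => inner ℝ (V (φ i) f) g) atTop (𝓝 (inner ℝ (Q f) g)) := by
  set e : ℕ → E := TopologicalSpace.denseSeq E
  have he : Dense (Set.range e) := TopologicalSpace.denseRange_denseSeq E
  have hbd : ∀ i f g, |inner ℝ (V i f) g| ≤ ‖f‖ * ‖g‖ := fun i f g =>
    (abs_real_inner_le_norm _ _).trans (by gcongr; exact hV i f)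
  -- A diagonal choice, done as compactness of a countable product of intervals. Convergence then
  -- extends from the dense sequence to all vectors, in the second variable directly and in the
  -- first through adjoints.
  obtain ⟨a, -, φ, hφ, hlim⟩ := (isCompact_univ_pi fun p : ℕ × ℕ =>
    (isCompact_Icc : IsCompact (Set.Icc (-(‖e p.1‖ * ‖e p.2‖)) (‖e p.1‖ * ‖e p.2‖)))).tendsto_subseq
    (x := fun i (p : ℕ × ℕ) => inner ℝ (V i (e p.1)) (e p.2))
    (fun i p _ => abs_le.1 (hbd i _ _))
  have c1 : ∀ m n, CauchySeq fun i => inner ℝ (V (φ i) (e m)) (e n) := fun m n =>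
    ((tendsto_pi_nhds.1 hlim) (m, n)).cauchySeq
  have c2 : ∀ m g, CauchySeq fun i => inner ℝ (V (φ i) (e m)) g := fun m g =>
    cauchySeq_inner_of_dense he (fun i => hV (φ i) (e m)) (by rintro _ ⟨n, rfl⟩; exact c1 m n) g
  have c3 : ∀ f g, CauchySeq fun i => inner ℝ (V (φ i) f) g := by
    intro f g
    have hadj : ∀ i f, inner ℝ (V (φ i) f) g = inner ℝ ((V (φ i)).adjoint g) f := fun i f => by
      rw [ContinuousLinearMap.adjoint_inner_left, real_inner_comm]
    simp only [hadj]
    refine cauchySeq_inner_of_dense he (C := ‖g‖) (fun i => ?_) ?_ f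
    · have hn : ‖V (φ i)‖ ≤ 1 :=
        ContinuousLinearMap.opNorm_le_bound _ zero_le_one fun f => by simpa using hV (φ i) f
      refine (ContinuousLinearMap.le_opNorm _ _).trans ?_
      rw [LinearIsometryEquiv.norm_map]
      exact mul_le_of_le_one_left (norm_nonneg g) hn
    · rintro _ ⟨m, rfl⟩
      simp only [← hadj]
      exact c2 m g
  choose b hb using fun f g => cauchySeq_tendsto_of_complete (c3 f g)
  let L : E →ₗ[ℝ] E →ₗ[ℝ] ℝ := LinearMap.mk₂ ℝ b
    (fun f f' g => tendsto_nhds_unique (hb _ _)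
      (((hb f g).add (hb f' g)).congr fun i => by rw [map_add, inner_add_left]))
    (fun r f g => tendsto_nhds_unique (hb _ _)
      (((hb f g).const_mul r).congr fun i => by rw [map_smul, real_inner_smul_left]))
    (fun f g g' => tendsto_nhds_unique (hb _ _)
      (((hb f g).add (hb f g')).congr fun i => by rw [inner_add_right]))
    (fun r f g => tendsto_nhds_unique (hb _ _)
      (((hb f g).const_mul r).congr fun i => by rw [real_inner_smul_right]))
  let L' : E →L[ℝ] E →L[ℝ] ℝ := L.mkContinuous₂ 1 fun f g => by
    rw [one_mul]
    exact le_of_tendsto' (hb f g).norm fun i => hbd _ _ _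
  refine ⟨φ, hφ, InnerProductSpace.continuousLinearMapOfBilin (𝕜 := ℝ) L', fun f g => ?_⟩
  rw [InnerProductSpace.continuousLinearMapOfBilin_apply]
  exact hb f g

end WeakOperator

/-! ### Positive operators on `L²` -/

section Positive

variable {X : Type*} [MeasurableSpace X] {μ : Measure X} [IsProbabilityMeasure μ]

lemma nonneg_of_inner_ind_nonneg {v : Lp ℝ 2 μ}
    (h : ∀ F (hF : MeasurableSet F), 0 ≤ inner ℝ v (ind hF)) : 0 ≤ v := by
  rw [← Lp.coeFn_nonneg]
  refine ae_nonneg_of_forall_setIntegral_nonneg ((Lp.memLp v).integrable one_le_two)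
    fun F hF _ => ?_
  rw [← L2.inner_indicatorConstLp_one (𝕜 := ℝ) hF (measure_ne_top μ F), real_inner_comm]
  exact h F hF

lemma inner_nonneg_of_nonneg {f g : Lp ℝ 2 μ} (hf : 0 ≤ f) (hg : 0 ≤ g) : 0 ≤ inner ℝ f g := by
  rw [← Lp.coeFn_nonneg] at hf hg
  rw [L2.inner_def]
  refine integral_nonneg_of_ae ?_
  filter_upwards [hf, hg] with x h1 h2
  exact mul_nonneg h2 h1

lemma ind_nonneg {D : Set X} (hD : MeasurableSet D) : 0 ≤ (ind hD : Lp ℝ 2 μ) :=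
  nonneg_of_inner_ind_nonneg fun F hF => by
    rw [inner_ind_ind]
    exact measureReal_nonneg

lemma map_nonneg_of_inner_ind_nonneg {R : Lp ℝ 2 μ →L[ℝ] Lp ℝ 2 μ}
    (h : ∀ D F (hD : MeasurableSet D) (hF : MeasurableSet F), 0 ≤ inner ℝ (R (ind hD)) (ind hF))
    {f : Lp ℝ 2 μ} (hf : 0 ≤ f) : 0 ≤ R f := by
  refine nonneg_of_inner_ind_nonneg fun F hF => ?_
  rw [← ContinuousLinearMap.adjoint_inner_right]
  refine inner_nonneg_of_nonneg hf (nonneg_of_inner_ind_nonneg fun D hD => ?_)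
  rw [ContinuousLinearMap.adjoint_inner_left, real_inner_comm]
  exact h D F hD hF

lemma eq_zero_of_inner_ind_eq_zero {v : Lp ℝ 2 μ}
    (h : ∀ F (hF : MeasurableSet F), inner ℝ v (ind hF) = 0) : v = 0 := by
  refine le_antisymm ?_ (nonneg_of_inner_ind_nonneg fun F hF => (h F hF).ge)
  rw [← neg_nonneg]
  refine nonneg_of_inner_ind_nonneg fun F hF => ?_
  rw [inner_neg_left, h F hF, neg_zero]

lemma ind_add_ind_compl {D : Set X} (hD : MeasurableSet D) :
    (ind hD + ind hD.compl : Lp ℝ 2 μ) = Lp.const 2 μ (1 : ℝ) := by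
  rw [const_one_eq_ind, ← sub_eq_zero]
  refine eq_zero_of_inner_ind_eq_zero fun F hF => ?_
  rw [inner_sub_left, inner_add_left, inner_ind_ind, inner_ind_ind, inner_ind_ind, Set.univ_inter,
    Set.inter_comm D, Set.inter_comm Dᶜ, ← Set.sdiff_eq, measureReal_inter_add_sdiff hD, sub_self]

/-- The images of an indicator and of its complement are nonnegative and add up to R 1 = 0, so both
vanish. -/
lemma eq_zero_of_inner_ind_nonneg {R : Lp ℝ 2 μ →L[ℝ] Lp ℝ 2 μ}
    (h : ∀ D F (hD : MeasurableSet D) (hF : MeasurableSet F), 0 ≤ inner ℝ (R (ind hD)) (ind hF))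
    (h1 : R (Lp.const 2 μ (1 : ℝ)) = 0) : R = 0 := by
  have hD : ∀ D (hD : MeasurableSet D), R (ind hD) = 0 := by
    intro D hD
    refine le_antisymm ?_ (map_nonneg_of_inner_ind_nonneg h (ind_nonneg hD))
    rw [← ind_add_ind_compl hD, map_add, add_eq_zero_iff_eq_neg] at h1
    rw [h1, neg_nonpos]
    exact map_nonneg_of_inner_ind_nonneg h (ind_nonneg hD.compl)
  ext1 f
  refine ext_inner_right ℝ fun g => ?_
  have hg : R.adjoint g = 0 := eq_zero_of_inner_ind_eq_zero fun D hDm => by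
    rw [ContinuousLinearMap.adjoint_inner_left, hD D hDm, inner_zero_right]
  rw [← ContinuousLinearMap.adjoint_inner_right, hg]
  simp

end Positive

/-! ### A criterion for partial rigidity -/

section Rigidity

variable {X : Type*} [MeasurableSpace X] {μ : Measure X} [IsProbabilityMeasure μ]

/-- Holds for each generating set once i exceeds its index, since the i-th code then records it. It
passes to complements and countable unions, a union costing two tails of equal measure because T
preserves μ. -/
lemma tendsto_measureReal_inter_symmDiff [MeasurableSpace.CountablyGenerated X] (T : Aut μ)
    {l : ℕ → ℕ} {U : ℕ → Set X}
    (h : Tendsto (fun i => μ.real {x | x ∈ U i ∧ code i (T^[l i] x) ≠ code i x}) atTop (𝓝 0))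
    {D : Set X} (hD : MeasurableSet D) :
    Tendsto (fun i => μ.real (U i ∩ symmDiff (T^[l i] ⁻¹' D) D)) atTop (𝓝 0) := by
  have hgen := MeasurableSpace.generateFrom_natGeneratingSequence X
  rw [← hgen] at hD
  induction D, hD using MeasurableSpace.generateFrom_induction with
  | hC D hDs _ =>
    obtain ⟨s, rfl⟩ := hDs
    refine squeeze_zero' (Eventually.of_forall fun _ => measureReal_nonneg) ?_ h
    filter_upwards [eventually_gt_atTop s] with i hi
    refine measureReal_mono ?_
    rintro x ⟨hxU, hx⟩
    refine ⟨hxU, fun heq => ?_⟩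
    have e1 : T^[l i] x ∈ MeasurableSpace.natGeneratingSequence X s ↔
        x ∈ MeasurableSpace.natGeneratingSequence X s :=
      decide_eq_decide.1 (congrFun heq ⟨s, hi⟩)
    rcases hx with ⟨p, q⟩ | ⟨p, q⟩
    · exact q (e1.1 p)
    · exact q (e1.2 p)
  | empty => simp
  | compl D _ ih =>
    simpa only [Set.preimage_compl, compl_symmDiff_compl] using ih
  | iUnion f hf ih =>
    rw [hgen] at hf
    set F := ⋃ n, f n
    have hacc : ∀ N, MeasurableSet (Set.accumulate f N) := fun N =>
      MeasurableSet.biUnion (Set.to_countable _) fun n _ => hf n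
    have hF : MeasurableSet F := MeasurableSet.iUnion hf
    have htail : Tendsto (fun N => μ.real (F \ Set.accumulate f N)) atTop (𝓝 0) := by
      have t1 : Tendsto (fun N => μ.real (Set.accumulate f N)) atTop (𝓝 (μ.real F)) :=
        (ENNReal.tendsto_toReal (measure_ne_top μ F)).comp tendsto_measure_iUnion_accumulate
      have t2 := t1.const_sub (μ.real F)
      rw [sub_self] at t2
      refine t2.congr fun N => ?_
      rw [measureReal_sdiff (Set.accumulate_subset_iUnion N) (hacc N)]
    rw [Metric.tendsto_atTop]
    intro ε hε
    obtain ⟨N, hN⟩ := (htail.eventually_lt_const (show 0 < ε / 3 by positivity)).exists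
    have hsum : Tendsto (fun i => ∑ n ∈ Finset.range (N + 1),
        μ.real (U i ∩ symmDiff (T^[l i] ⁻¹' f n) (f n))) atTop (𝓝 0) := by
      have := tendsto_finsetSum (Finset.range (N + 1)) fun n _ => ih n
      simpa using this
    obtain ⟨M, hM⟩ := eventually_atTop.1
      (hsum.eventually_lt_const (show 0 < ε / 3 by positivity))
    refine ⟨M, fun i hi => ?_⟩
    rw [Real.dist_eq, sub_zero, abs_of_nonneg measureReal_nonneg]
    have hsub : U i ∩ symmDiff (T^[l i] ⁻¹' F) F ⊆
        (⋃ n ∈ Finset.range (N + 1), U i ∩ symmDiff (T^[l i] ⁻¹' f n) (f n)) ∪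
          ((F \ Set.accumulate f N) ∪ T^[l i] ⁻¹' (F \ Set.accumulate f N)) := by
      rintro x ⟨hxU, hx⟩
      by_contra hcon
      simp only [Set.mem_union, not_or, Set.mem_iUnion, Finset.mem_range, not_exists] at hcon
      obtain ⟨n1, n2, n3⟩ := hcon
      rcases hx with ⟨p, q⟩ | ⟨p, q⟩
      · have hp : T^[l i] x ∈ Set.accumulate f N := by
          by_contra hp
          exact n3 ⟨p, hp⟩
        obtain ⟨n, hn, hpn⟩ := Set.mem_accumulate.1 hp
        exact n1 n (Nat.lt_succ_of_le hn)
          ⟨hxU, Or.inl ⟨hpn, fun hq => q (Set.mem_iUnion.2 ⟨n, hq⟩)⟩⟩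
      · have hp : x ∈ Set.accumulate f N := by
          by_contra hp
          exact n2 ⟨p, hp⟩
        obtain ⟨n, hn, hpn⟩ := Set.mem_accumulate.1 hp
        exact n1 n (Nat.lt_succ_of_le hn)
          ⟨hxU, Or.inr ⟨hpn, fun hq => q (Set.mem_iUnion.2 ⟨n, hq⟩)⟩⟩
    have u1 := (measureReal_mono (μ := μ) hsub).trans (measureReal_union_le _ _)
    have u2 := measureReal_biUnion_finset_le (μ := μ) (Finset.range (N + 1))
      fun n => U i ∩ symmDiff (T^[l i] ⁻¹' f n) (f n)
    have u3 := measureReal_union_le (μ := μ) (F \ Set.accumulate f N)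
      (T^[l i] ⁻¹' (F \ Set.accumulate f N))
    rw [(T.2.iterate (l i)).measureReal_preimage (hF.diff (hacc N)).nullMeasurableSet] at u3
    have u4 := hM i hi
    linarith

/-- If the powers `T^{l i}` are close to the identity on almost invariant sets of measure at least
`ρ - o(1)`, then `T` is partially rigid with exponent `ρ`. -/
lemma isPartiallyRigid_of_tendsto [MeasurableSpace.CountablyGenerated X] (T : Aut μ)
    (hT : Ergodic T μ) {ρ : ℝ} (hρ : ρ ≤ 1) {l : ℕ → ℕ} (hl : ∀ i, i ≤ l i) {U : ℕ → Set X}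
    (hU : ∀ i, MeasurableSet (U i))
    (hmass : ∀ η > 0, ∀ᶠ i in atTop, ρ - η ≤ μ.real (U i))
    (hinv : Tendsto (fun i => μ.real (symmDiff (T ⁻¹' U i) (U i))) atTop (𝓝 0))
    (hcode : Tendsto (fun i => μ.real {x | x ∈ U i ∧ code i (T^[l i] x) ≠ code i x}) atTop (𝓝 0)) :
    IsPartiallyRigid T ρ := by
  have : Fact ((2 : ENNReal) ≠ ⊤) := ⟨ENNReal.ofNat_ne_top⟩
  obtain ⟨φ, hφ, Q, hQ⟩ := exists_subseq_weakOperator_tendsto (fun i => T.koopman ^ l i)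
    fun i f => (norm_koopman_pow T (l i) f).le
  set one : Lp ℝ 2 μ := Lp.const 2 μ (1 : ℝ) with hone
  have hK1 : ∀ i, (T.koopman ^ i) one = one := fun i => by
    rw [hone, const_one_eq_ind, koopman_pow_ind]
    rfl
  have hQ1 : Q one = one := ext_inner_right ℝ fun g => by
    refine tendsto_nhds_unique (hQ one g) ?_
    simp only [hK1]
    exact tendsto_const_nhds
  have hQ1' : Q.adjoint one = one := ext_inner_right ℝ fun g => by
    rw [ContinuousLinearMap.adjoint_inner_left, real_inner_comm]
    refine tendsto_nhds_unique (hQ g one) ?_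
    have : ∀ i, inner ℝ ((T.koopman ^ l (φ i)) g) one = inner ℝ one g := fun i => by
      rw [← hK1 (l (φ i)), inner_koopman_pow, hK1, real_inner_comm]
    simp only [this]
    exact tendsto_const_nhds
  -- Positivity of Q - ρI is the heart of the criterion: μ(T^{-l}D ∩ F) is at least μ(U ∩ D ∩ F) up
  -- to o(1), and near-independence makes this at least ρ·μ(D ∩ F) up to o(1).
  set R : Lp ℝ 2 μ →L[ℝ] Lp ℝ 2 μ := Q - ρ • ContinuousLinearMap.id ℝ _ with hR
  have hRapp : ∀ f, R f = Q f - ρ • f := fun f => rfl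
  have hpos : ∀ D F (hD : MeasurableSet D) (hF : MeasurableSet F),
      0 ≤ inner ℝ (R (ind hD)) (ind hF) := by
    intro D F hD hF
    rw [hRapp, inner_sub_left, real_inner_smul_left, inner_ind_ind, sub_nonneg]
    refine le_of_forall_pos_sub_le fun η hη => ?_
    obtain ⟨κ, hκ, hind⟩ := exists_almost_independent T hT (hD.inter hF)
      (show 0 < η / 3 by positivity)
    refine ge_of_tendsto (hQ (ind hD) (ind hF)) ?_
    have ev : ∀ᶠ i in atTop, ρ * μ.real (D ∩ F) - η ≤
        inner ℝ ((T.koopman ^ l i) (ind hD)) (ind hF) := by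
      filter_upwards [hmass (η / 3) (by positivity), hinv.eventually_lt_const hκ,
        (tendsto_measureReal_inter_symmDiff T hcode hD).eventually_lt_const
          (show 0 < η / 3 by positivity)] with i h1 h2 h3
      rw [koopman_pow_ind, inner_ind_ind]
      have h4 := (abs_le.1 (hind (U i) (hU i) h2.le)).1
      have h5 : μ.real (U i ∩ (D ∩ F)) ≤ μ.real (T^[l i] ⁻¹' D ∩ F) +
          μ.real (U i ∩ symmDiff (T^[l i] ⁻¹' D) D) := by
        refine (measureReal_mono ?_).trans (measureReal_union_le _ _)
        rintro x ⟨hxU, hxD, hxF⟩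
        by_cases hx : T^[l i] x ∈ D
        · exact Or.inl ⟨hx, hxF⟩
        · exact Or.inr ⟨hxU, Or.inr ⟨hxD, hx⟩⟩
      have h6 : (ρ - η / 3) * μ.real (D ∩ F) ≤ μ.real (U i) * μ.real (D ∩ F) := by
        gcongr
      have h7 : μ.real (D ∩ F) ≤ 1 := measureReal_le_one
      have h8 : η / 3 * μ.real (D ∩ F) ≤ η / 3 := mul_le_of_le_one_right (by positivity) h7
      linarith
    exact hφ.tendsto_atTop.eventually ev
  have hR1 : R one = (1 - ρ) • one := by rw [hRapp, hQ1, sub_smul, one_smul]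
  have hlφ : Tendsto (fun i => l (φ i)) atTop atTop :=
    tendsto_atTop_mono (fun i => hl (φ i)) hφ.tendsto_atTop
  refine ⟨fun i => l (φ i), hlφ, ?_⟩
  -- For ρ = 1 one cannot divide by 1 - ρ; instead R 1 = 0 forces R = 0, and the identity serves as
  -- the Markov operator.
  rcases eq_or_lt_of_le hρ with rfl | hlt
  · have hR0 : R = 0 := eq_zero_of_inner_ind_nonneg hpos (by rw [hR1, sub_self, zero_smul])
    refine ⟨ContinuousLinearMap.id ℝ _, ⟨fun f hf => hf, rfl, ?_⟩, fun f g => ?_⟩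
    · refine ext_inner_right ℝ fun g => ?_
      rw [ContinuousLinearMap.adjoint_inner_left]
      rfl
    · have hQf : Q f = f := by
        have := hRapp f
        rw [hR0, one_smul] at this
        exact (sub_eq_zero.1 this.symm)
      have := hQ f g
      rw [hQf] at this
      simpa using this
  · have hpos1 : 0 < 1 - ρ := sub_pos.2 hlt
    refine ⟨(1 - ρ)⁻¹ • R, ⟨fun f hf => ?_, ?_, ?_⟩, fun f g => ?_⟩
    · refine nonneg_of_inner_ind_nonneg fun F hF => ?_
      rw [smul_apply, real_inner_smul_left]
      exact mul_nonneg (inv_nonneg.2 hpos1.le)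
        (inner_nonneg_of_nonneg (map_nonneg_of_inner_ind_nonneg hpos hf) (ind_nonneg hF))
    · change (1 - ρ)⁻¹ • R one = one
      rw [hR1, smul_smul, inv_mul_cancel₀ hpos1.ne', one_smul]
    · refine ext_inner_right ℝ fun g => ?_
      rw [ContinuousLinearMap.adjoint_inner_left]
      change inner ℝ one ((1 - ρ)⁻¹ • (Q g - ρ • g)) = inner ℝ one g
      rw [real_inner_smul_right, inner_sub_right, ← ContinuousLinearMap.adjoint_inner_left, hQ1',
        real_inner_smul_right]
      field_simp
    · have : ρ • f + (1 - ρ) • ((1 - ρ)⁻¹ • R) f = Q f := by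
        rw [smul_apply, smul_smul, mul_inv_cancel₀ hpos1.ne', one_smul, hRapp]
        abel
      rw [this]
      exact hQ f g

/-- The points of period l form an invariant set, so by ergodicity T^l = I. The powers along
multiples of l are then constantly I = ρI + (1 - ρ)I, for any ρ. -/
lemma isPartiallyRigid_of_periodic (T : Aut μ) (hT : Ergodic T μ) {ρ : ℝ} {l : ℕ}
    (hl : 1 ≤ l) (hper : 0 < μ.real {x | T^[l] x = x}) [MeasurableSpace.CountablyGenerated X]
    [MeasurableSingletonClass X] : IsPartiallyRigid T ρ := by
  have hm : MeasurableSet {x | T^[l] x = x} :=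
    measurableSet_setOf_eq (T.1.measurable.iterate l) measurable_id
  have hinv : T ⁻¹' {x | T^[l] x = x} = {x | T^[l] x = x} := by
    ext x
    simp only [Set.mem_preimage, Set.mem_ofPred_eq]
    rw [← Function.iterate_succ_apply, Function.iterate_succ_apply']
    exact T.1.injective.eq_iff
  have hae : ∀ᵐ x ∂μ, T^[l] x = x := by
    rcases hT.ae_mem_or_ae_notMem hm hinv with h | h
    · exact h
    · have : μ {x | T^[l] x = x} = 0 := by
        rw [← compl_mem_ae_iff]
        exact h
      rw [measureReal_def, this] at hper
      simp at hper
  have hpow : T.koopman ^ l = 1 := by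
    ext1 f
    apply Lp.ext
    have e1 : ∀ n, (T.koopman ^ n) f =ᵐ[μ] f ∘ T^[n] := by
      intro n
      induction n with
      | zero => exact EventuallyEq.rfl
      | succ n ih =>
        have a1 : T.koopman ((T.koopman ^ n) f) =ᵐ[μ] ((T.koopman ^ n) f) ∘ T :=
          Lp.coeFn_compMeasurePreserving _ T.2
        rw [pow_succ', mul_apply_eq_comp]
        exact a1.trans (T.2.quasiMeasurePreserving.ae_eq_comp ih)
    filter_upwards [e1 l, hae] with x h1 h2
    rw [h1, Function.comp_apply, h2]
    rfl
  refine ⟨fun i => l * i, tendsto_id.const_mul_atTop' (by omega),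
    ContinuousLinearMap.id ℝ _, ⟨fun f hf => hf, rfl, ?_⟩, fun f g => ?_⟩
  · refine ext_inner_right ℝ fun g => ?_
    rw [ContinuousLinearMap.adjoint_inner_left]
    rfl
  · have : ρ • f + (1 - ρ) • (ContinuousLinearMap.id ℝ (Lp ℝ 2 μ)) f = f := by
      rw [ContinuousLinearMap.id_apply, ← add_smul]
      simp
    rw [this]
    simp only [pow_mul, hpow, one_pow]
    exact tendsto_const_nhds

end Rigidity

/-! ### Uniform nonrigidity and the final choice of constants. -/

section Main

variable {X : Type*} [MeasurableSpace X] [StandardBorelSpace X] {μ : Measure X}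
  [IsProbabilityMeasure μ]

/-- If an aperiodic `T` is not partially rigid with exponent `ρ`, then no power of `T` is close to
the identity on an almost invariant set of measure close to `ρ`. -/
lemma exists_uniform_nonrigidity (T : Aut μ) (hT : Ergodic T μ) {ρ : ℝ} (hρ0 : 0 < ρ)
    (hρ : ρ ≤ 1) (hrigid : ¬ IsPartiallyRigid T ρ)
    (haper : ∀ l ≥ 1, μ.real {x | T^[l] x = x} = 0) :
    ∃ δ > 0, ∃ n₀, ∀ n ≥ n₀, ∀ l ≥ 1, ∀ U : Set X, MeasurableSet U → ρ - δ ≤ μ.real U →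
      μ.real (symmDiff (T ⁻¹' U) U) ≤ δ →
        δ ≤ μ.real {x | x ∈ U ∧ code n (T^[l] x) ≠ code n x} := by
  by_contra hcon
  push Not at hcon
  have step : ∀ i : ℕ, ∃ l, i ≤ l ∧ ∃ U : Set X, MeasurableSet U ∧
      ρ - 1 / ((i : ℝ) + 1) ≤ μ.real U ∧ μ.real (symmDiff (T ⁻¹' U) U) ≤ 1 / ((i : ℝ) + 1) ∧
      μ.real {x | x ∈ U ∧ code i (T^[l] x) ≠ code i x} ≤ 1 / ((i : ℝ) + 1) := by
    intro i
    -- This forces l > i, so that the exponents tend to infinity: by aperiodicity a fine code agrees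
    -- under T^l, 1 ≤ l ≤ i, only on measure below ρ/4, whereas U has measure at least 3ρ/4 and
    -- changes code on less than ρ/4.
    have hsmall : ∀ᶠ n in atTop, ∀ l ∈ Finset.Icc 1 i,
        μ.real {x | x ∈ Set.univ ∧ code n (T^[l] x) = code n x} < ρ / 4 := by
      rw [Filter.eventually_all_finset]
      intro l hl
      have lim := tendsto_measureReal_code_eq μ (T.1.measurable.iterate l) measurable_id
        MeasurableSet.univ
      have h0 : μ.real {x | x ∈ Set.univ ∧ T^[l] x = id x} = 0 := by
        simpa using haper l (Finset.mem_Icc.1 hl).1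
      change Tendsto _ _ (𝓝 (μ.real {x | x ∈ Set.univ ∧ T^[l] x = id x})) at lim
      rw [h0] at lim
      exact lim.eventually_lt_const (by positivity)
    obtain ⟨n₁, hn₁⟩ := eventually_atTop.1 hsmall
    obtain ⟨n, hn, l, hl, U, hU, hm, hs, hc⟩ := hcon (min (1 / ((i : ℝ) + 1)) (ρ / 4))
      (lt_min (by positivity) (by positivity)) (max i n₁)
    have d1 : min (1 / ((i : ℝ) + 1)) (ρ / 4) ≤ 1 / ((i : ℝ) + 1) := min_le_left _ _
    have d2 : min (1 / ((i : ℝ) + 1)) (ρ / 4) ≤ ρ / 4 := min_le_right _ _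
    refine ⟨l, ?_, U, hU, by linarith, hs.trans d1, ?_⟩
    · by_contra hlt
      have h1 := hn₁ n ((le_max_right _ _).trans hn) l (Finset.mem_Icc.2 ⟨hl, by omega⟩)
      have h2 : μ.real U ≤ μ.real {x | x ∈ U ∧ code n (T^[l] x) ≠ code n x} +
          μ.real {x | x ∈ Set.univ ∧ code n (T^[l] x) = code n x} := by
        refine (measureReal_mono ?_).trans (measureReal_union_le _ _)
        intro x hx
        by_cases he : code n (T^[l] x) = code n x
        · exact Or.inr ⟨trivial, he⟩
        · exact Or.inl ⟨hx, he⟩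
      linarith
    · refine le_trans (measureReal_mono ?_) (hc.le.trans d1)
      exact fun x hx => ⟨hx.1, fun he => hx.2 (code_eq_of_le ((le_max_left _ _).trans hn) he)⟩
  choose l hl U hU hm hs hc using step
  have lim : Tendsto (fun i : ℕ => 1 / ((i : ℝ) + 1)) atTop (𝓝 0) :=
    tendsto_one_div_add_atTop_nhds_zero_nat
  refine hrigid (isPartiallyRigid_of_tendsto T hT hρ hl hU (fun η hη => ?_)
    (squeeze_zero (fun _ => measureReal_nonneg) hs lim)
    (squeeze_zero (fun _ => measureReal_nonneg) hc lim))
  filter_upwards [lim.eventually_lt_const hη] with i hi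
  linarith [hm i]

set_option maxHeartbeats 400000 in
/-- A weakly homoclinic automorphism fixes almost every point. -/
lemma measureReal_moved_eq_zero (T : Aut μ) (hT : Ergodic T μ) (hβ : 0 < localRank μ T)
    (hrigid : ¬ IsPartiallyRigid T (localRank μ T)) {S : Aut μ} (hS : S ∈ WH T) :
    μ.real {x | S x ≠ x} = 0 := by
  set β := localRank μ T
  have hβ1 : β ≤ 1 := localRank_le_one T
  have haper : ∀ l ≥ 1, μ.real {x | T^[l] x = x} = 0 := by
    intro l hl
    by_contra hne
    exact hrigid (isPartiallyRigid_of_periodic T hT hl (lt_of_le_of_ne measureReal_nonneg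
      (Ne.symm hne)))
  have : NullSingletonClass μ := noAtoms_of_aperiodic T haper
  obtain ⟨δ₀, hδ₀, n₀, hnr⟩ := exists_uniform_nonrigidity T hT hβ hβ1 hrigid haper
  set A := {x | S x ≠ x} with hA
  have hAm : MeasurableSet A := (measurableSet_setOf_eq S.1.measurable measurable_id).compl
  by_contra hne
  have ha : 0 < μ.real A := lt_of_le_of_ne measureReal_nonneg (Ne.symm hne)
  set a := μ.real A
  obtain ⟨δ, hδ, hδ1, hδδ⟩ : ∃ δ > 0, δ ≤ 1 ∧ δ ≤ δ₀ :=
    ⟨min 1 δ₀, lt_min one_pos hδ₀, min_le_left _ _, min_le_right _ _⟩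
  -- The bottom K levels will have measure at least δβ/32, so their expected share of A is at least
  -- 8θ. Near-independence costs θ, while the upper bound consists of four terms of at most θ each.
  set θ := δ * β * a / 256 with hθdef
  have hθ : 0 < θ := by positivity
  obtain ⟨κ, hκ, hind⟩ := exists_almost_independent T hT hAm hθ
  have hlim := tendsto_measureReal_code_eq μ S.1.measurable measurable_id hAm
  have h0 : μ.real {x | x ∈ A ∧ S x = id x} = 0 := by
    have : {x | x ∈ A ∧ S x = id x} = ∅ := by
      ext x
      simp only [Set.mem_ofPred_eq, Set.mem_empty_iff_false, iff_false]
      exact fun h => h.1 h.2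
    rw [this, measureReal_empty]
  change Tendsto _ _ (𝓝 (μ.real {x | x ∈ A ∧ S x = id x})) at hlim
  rw [h0] at hlim
  obtain ⟨n, hn, hnθ⟩ := ((eventually_ge_atTop n₀).and (hlim.eventually_lt_const hθ)).exists
  -- The allowance will be r = εh. The first bound makes 2r/K ≤ θ for K ≥ δh/16; the second keeps
  -- 2r·μ(B) ≤ δ/4.
  set ε := min (θ * δ / 32) (δ / 8) with hεdef
  have hε : 0 < ε := lt_min (by positivity) (by positivity)
  have hε1 : ε ≤ θ * δ / 32 := min_le_left _ _
  have hε2 : ε ≤ δ / 8 := min_le_right _ _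
  set η := min (min (δ / 8) (β / 2)) (θ * ε / 2)
  have hη : 0 < η := lt_min (lt_min (by positivity) (by positivity)) (by positivity)
  have hη1 : η ≤ δ / 8 := (min_le_left _ _).trans (min_le_left _ _)
  have hη2 : η ≤ β / 2 := (min_le_left _ _).trans (min_le_right _ _)
  have hη3 : η ≤ θ * ε / 2 := min_le_right _ _
  have havg := (tendsto_average_mismatch T S hS (code n) (measurable_code n)).eventually_lt_const
    (show 0 < θ * ε / 4 by positivity)
  obtain ⟨H, hH1, hH2, hH3, hH4⟩ : ∃ H : ℕ, 16 / δ ≤ (H : ℝ) ∧ 2 / κ ≤ (H : ℝ) ∧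
      4 / (ε * θ) ≤ (H : ℝ) ∧ ∀ h ≥ H, (h : ℝ)⁻¹ * ∑ i ∈ Finset.Icc 1 h,
        μ.real {y | code n (T^[i] (S y)) ≠ code n (T^[i] y)} < θ * ε / 4 := by
    obtain ⟨N, hN⟩ := eventually_atTop.1 havg
    have hr : ∀ x : ℝ, ∀ᶠ H : ℕ in atTop, x ≤ (H : ℝ) := fun x =>
      tendsto_natCast_atTop_atTop.eventually_ge_atTop x
    obtain ⟨H, ⟨h1, h2⟩, h3, h4⟩ := (((hr (16 / δ)).and (hr (2 / κ))).and
      ((hr (4 / (ε * θ))).and (eventually_ge_atTop N))).exists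
    exact ⟨H, h1, h2, h3, fun h hh => hN h (h4.trans hh)⟩
  obtain ⟨B, h, w, hB, hHh, hmass, herr⟩ := exists_high_tower (μ := μ) hβ n H hη
  have hHh' : (H : ℝ) ≤ h := by exact_mod_cast hHh
  have hpos : (0 : ℝ) < h := lt_of_lt_of_le (by positivity) (hH1.trans hHh')
  have hB1 : h * μ.real B ≤ 1 := hB.mul_measureReal_le_one
  have hBnn : 0 ≤ μ.real B := measureReal_nonneg
  have hhδ : 16 ≤ δ * h := by
    have := hH1.trans hHh'
    rw [div_le_iff₀ hδ] at this
    linarith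
  have hBδ : 16 * μ.real B ≤ δ := by
    have : 16 * μ.real B ≤ δ * h * μ.real B := mul_le_mul_of_nonneg_right hhδ hBnn
    linarith [mul_le_mul_of_nonneg_left hB1 hδ.le]
  have hBκ : 2 * μ.real B ≤ κ := by
    have h1 := hH2.trans hHh'
    rw [div_le_iff₀ hκ] at h1
    have : 2 * μ.real B ≤ h * κ * μ.real B := mul_le_mul_of_nonneg_right h1 hBnn
    linarith [mul_le_mul_of_nonneg_left hB1 hκ.le]
  -- Small enough that discarding 2K levels loses at most δ/4 of the tower, yet a fixed fraction of
  -- the height: δh ≥ 16 absorbs the rounding and leaves K ≥ δh/16.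
  set K := ⌊δ * h / 8⌋₊
  have hK1 : (K : ℝ) ≤ δ * h / 8 := Nat.floor_le (by positivity)
  have hK2 : δ * h / 16 ≤ K := by
    have := Nat.lt_floor_add_one (δ * h / 8)
    change δ * h / 8 < (K : ℝ) + 1 at this
    linarith
  have hKpos : (0 : ℝ) < K := lt_of_lt_of_le (by positivity) hK2
  have hKh : 8 * (K : ℝ) ≤ h := by linarith [mul_le_of_le_one_left hpos.le hδ1]
  have hK2h : 2 * K ≤ h := by
    have : (2 : ℝ) * K ≤ h := by linarith
    exact_mod_cast this
  have hτ0 : 0 ≤ towerError μ T (code n) w B h := Finset.sum_nonneg fun _ _ => measureReal_nonneg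
  have hsumS : ∑ i ∈ Finset.range h, μ.real {y | code n (T^[i] (S y)) ≠ code n (T^[i] y)} ≤
      1 + h * (θ * ε / 4) := by
    have h1 := hH4 h hHh
    rw [inv_mul_lt_iff₀ hpos] at h1
    have h2 : ∑ i ∈ Finset.range h, μ.real {y | code n (T^[i] (S y)) ≠ code n (T^[i] y)} ≤
        -- The averages defining `WH` start at i = 1 and names at i = 0; the extra term is bounded
        -- by 1 and absorbed by h ≥ 4/(εθ).
        ∑ i ∈ insert 0 (Finset.Icc 1 h),
          μ.real {y | code n (T^[i] (S y)) ≠ code n (T^[i] y)} := by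
      refine Finset.sum_le_sum_of_subset_of_nonneg ?_ fun _ _ _ => measureReal_nonneg
      intro i hi
      have := Finset.mem_range.1 hi
      simp only [Finset.mem_insert, Finset.mem_Icc]
      omega
    rw [Finset.sum_insert (by simp)] at h2
    have h3 : μ.real {y | code n (T^[0] (S y)) ≠ code n (T^[0] y)} ≤ 1 := measureReal_le_one
    linarith
  have hmain := measureReal_column_inter_ne_le T S (measurable_code n) w (A := A) hB
    (r := ε * h) (δ := δ) (β := β) (by positivity) (K := K) (by exact_mod_cast hKpos) hK2h
    (fun l hl U hU h1 h2 => hδδ.trans (hnr n hn l hl U hU (by linarith) (h2.trans hδδ)))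
    (by linarith [mul_le_mul_of_nonneg_left hB1 hε.le]) (by linarith)
    (by
      rw [Nat.cast_sub hK2h]
      push_cast
      have : K * μ.real B ≤ δ / 8 := by
        calc K * μ.real B ≤ δ * h / 8 * μ.real B := mul_le_mul_of_nonneg_right hK1 hBnn
          _ = δ / 8 * (h * μ.real B) := by ring
          _ ≤ δ / 8 * 1 := by gcongr
          _ = δ / 8 := mul_one _
      linarith) hsumS
  have b1 : 2 / (ε * h) * (1 + h * (θ * ε / 4)) ≤ θ := by
    have h1 := hH3.trans hHh'
    rw [div_le_iff₀ (by positivity)] at h1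
    rw [div_mul_eq_mul_div, div_le_iff₀ (by positivity)]
    linarith
  have b2 : 2 / (ε * h) * (K * towerError μ T (code n) w B h) ≤ θ := by
    rw [div_mul_eq_mul_div, div_le_iff₀ (by positivity)]
    have : K * towerError μ T (code n) w B h ≤ h * (θ * ε / 2) := by
      have : (K : ℝ) ≤ h := by linarith
      gcongr
      exact herr.trans hη3
    linarith
  have b3 : 2 * (ε * h / K) ≤ θ := by
    rw [← mul_div_assoc, div_le_iff₀ hKpos]
    calc 2 * (ε * h) ≤ 2 * (θ * δ / 32 * h) := by gcongr
      _ = θ * (δ * h / 16) := by ring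
      _ ≤ θ * K := by gcongr
  have b4 : μ.real {y | y ∈ A ∧ code n (S y) = code n y} ≤ θ := hnθ.le
  have low1 := (abs_le.1 (hind (column T B 0 K) (measurableSet_column T hB.measurableSet 0 K)
    ((measureReal_symmDiff_column_le T hB.measurableSet 0 K).trans hBκ))).1
  rw [measureReal_column T hB (by omega), Nat.sub_zero] at low1
  have low2 : δ * β / 32 ≤ K * μ.real B := by
    calc δ * β / 32 = δ / 16 * (β / 2) := by ring
      _ ≤ δ / 16 * (h * μ.real B) := by
          gcongr
          linarith
      _ = δ * h / 16 * μ.real B := by ring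
      _ ≤ K * μ.real B := by gcongr
  have low3 : 8 * θ ≤ K * μ.real B * a := by
    calc 8 * θ = δ * β / 32 * a := by rw [hθdef]; ring
      _ ≤ K * μ.real B * a := by gcongr
  linarith

end Main

end WeaklyHomoclinic

theorem mainTheorem10 {X : Type*} [MeasurableSpace X] [StandardBorelSpace X]
    (μ : Measure X) [IsProbabilityMeasure μ] (T : Aut μ) (hT : Ergodic T μ)
    (hβ : 0 < localRank μ T) (hrigid : ¬ IsPartiallyRigid T (localRank μ T)) :
    WH T = {S : Aut μ | S =ᵐ[μ] id} := by
  ext S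
  refine ⟨fun hS => ?_, fun hS => WeaklyHomoclinic.ae_eq_id_mem_WH T S hS⟩
  have h := WeaklyHomoclinic.measureReal_moved_eq_zero T hT hβ hrigid hS
  rw [measureReal_eq_zero_iff] at h
  exact h
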